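/- Let $n\ge 2$, $m\ge 1$, and let $\Omega\subset\mathbb{R}^n$ be open, bounded and connected with $0\in\Omega$. Assume that $\Omega$ is convex in the $x_1$-direction (if $p,q\in\Omega$ satisfy $p_j=q_j$ for all $j\ge 2$, then the segment from $p$ to $q$ lies in $\Omega$) and symmetric under $(x_1,x_2,\dots,x_n)\mapsto(-x_1,x_2,\dots,x_n)$. Let $\alpha=(\alpha_1,\dots,\alpha_m)\in\mathbb{R}^m$ and define $s_0(\alpha),\dots,s_m(\alpha)$ by $\prod_{i=1}^m(\alpha_i+t)=\sum_{k=0}^m s_k(\alpha)t^k$, that is, $s_m(\alpha)=1$ and $$s_k(\alpha)=\sum_{1\le i_1<\dots<i_{m-k}\le m}\alpha_{i_1}\cdots\alpha_{i_{m-k}}\qquad(0\le k\le m-1).$$ Assume $s_0(\alpha),\dots,s_{m-1}(\alpha)\ge 0$. Let $f:[0,\infty)\to\mathbb{R}$ be globally Lipschitz continuous and non-decreasing, with $f(0)\ge 0$. Let $u\in C^{2m}(\Omega\setminus\{0\})\cap C^{2m-2}(\overline\Omega\setminus\{0\})$ satisfy $$\begin{cases}\displaystyle\sum_{k=0}^m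 s_k(\alpha)(-\Delta)^k u=f(u) & \text{in }\Omega\setminus\{0\},\\ u>0 & \text{in }\Omega\setminus\{0\},\\ u=-\Delta u=\dots=(-\Delta)^{m-1}u=0 & \text{on }\partial\Omega,\\ \displaystyle\inf_{\Omega\setminus\{0\}}(-\Delta)^j u>-\infty & \text{for } j=1,\dots,m-1.\end{cases}$$ Here $u\in C^{2m-2}(\overline\Omega\setminus\{0\})$ means that all derivatives of $u$ of order at most $2m-2$ extend continuously to $\overline\Omega\setminus\{0\}$, and the boundary values are those of the extensions. Then: 1. $u$ is symmetric in $x_1$: $u(-x_1,x_2,\dots,x_n)=u(x_1,x_2,\dots,x_n)$ for every $x\in\Omega\setminus\{0\}$. 2. $u$ is strictly decreasing in $x_1$ on $\Omega\cap\{x_1>0\}$: if $p,q\in\Omega$ satisfy $p_j=q_j$ for all $j\ge2$ and $0<p_1<q_1$, then $u(q)<u(p)$. -/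

import Mathlib

open Set Filter Topology

/-- Reflection across the hyperplane `{x₁ = 0}`: `(x₁, x₂, …, xₙ) ↦ (-x₁, x₂, …, xₙ)`.
The first coordinate `x₁` is `x 0`. -/
def reflectX1 {n : ℕ} [NeZero n] (x : EuclideanSpace ℝ (Fin n)) : EuclideanSpace ℝ (Fin n) :=
  WithLp.toLp 2 (fun j => if j = 0 then -x j else x j)

/-- A bounded domain (bounded, open, connected set) of `ℝⁿ` that is convex in the
`x₁`-direction, symmetric with respect to `{x₁ = 0}`, and contains the origin. -/
structure IsSymmetricX1Domain {n : ℕ} [NeZero n] (Ω : Set (EuclideanSpace ℝ (Fin n))) :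
    Prop where
  isOpen : IsOpen Ω
  isBounded : Bornology.IsBounded Ω
  isConnected : IsConnected Ω
  convexX1 : ∀ p ∈ Ω, ∀ q ∈ Ω, (∀ j, j ≠ 0 → p j = q j) →
    ∀ t ∈ Icc (0 : ℝ) 1, (1 - t) • p + t • q ∈ Ω
  symmetric : ∀ p ∈ Ω, reflectX1 p ∈ Ω
  zero_mem : (0 : EuclideanSpace ℝ (Fin n)) ∈ Ω

/-- `(-Δ)^j u`, the `j`-fold iterate of minus the Laplacian. -/
noncomputable def negLaplacianPow {n : ℕ} (j : ℕ) (u : EuclideanSpace ℝ (Fin n) → ℝ) :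
    EuclideanSpace ℝ (Fin n) → ℝ :=
  (fun v : EuclideanSpace ℝ (Fin n) → ℝ => -Laplacian.laplacian v)^[j] u

/-- For `k ≤ m`, `s_k(α)` is the elementary symmetric function of degree `m - k` of
`α₁, …, α_m`; in particular `s_m(α) = 1`. -/
def symmCoeff {m : ℕ} (α : Fin m → ℝ) (k : ℕ) : ℝ :=
  ∑ S ∈ Finset.powersetCard (m - k) (Finset.univ : Finset (Fin m)), ∏ i ∈ S, α i

/-- The `s_k(α)` are the coefficients of `det diag(α₁ + t, …, α_m + t)`. -/
theorem det_diagonal_add_eq_sum_symmCoeff {m : ℕ} (α : Fin m → ℝ) (t : ℝ) :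
    (Matrix.diagonal (fun i => α i + t)).det =
      ∑ k ∈ Finset.range (m + 1), symmCoeff α k * t ^ k := by
  rw [Matrix.det_diagonal, Finset.prod_add, Finset.sum_powerset]
  rw [← Finset.sum_range_reflect]
  simp only [Finset.card_univ, Fintype.card_fin]
  refine Finset.sum_congr rfl fun k hk => ?_
  have hk' : k ≤ m := by simpa [Nat.lt_succ_iff] using hk
  rw [symmCoeff, Finset.sum_mul]
  have e : m + 1 - 1 - k = m - k := by omega
  rw [e]
  refine Finset.sum_congr rfl fun S hS => ?_
  rw [Finset.mem_powersetCard] at hS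
  rw [Finset.prod_const, Finset.card_sdiff_of_subset (Finset.subset_univ S), hS.2]
  have e2 : (Finset.univ : Finset (Fin m)).card - (m - k) = k := by simp; omega
  rw [e2]

/-- Regularity up to the boundary away from the origin: `u ∈ C^r(Ω̄ ∖ {0})`. That is, `u` is of
class `C^r` on `Ω ∖ {0}` and each derivative of order at most `r` extends continuously to
`Ω̄ ∖ {0}`. Only the values of `u` on `Ω ∖ {0}` matter (for open `Ω`). -/
def IsCrUpToBoundary {n : ℕ} (r : ℕ) (Ω : Set (EuclideanSpace ℝ (Fin n)))
    (u : EuclideanSpace ℝ (Fin n) → ℝ) : Prop :=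
  ContDiffOn ℝ (r : WithTop ℕ∞) u (Ω \ {0}) ∧
  ∀ k : ℕ, k ≤ r →
    ∃ g : EuclideanSpace ℝ (Fin n) →
        ContinuousMultilinearMap ℝ (fun _ : Fin k => EuclideanSpace ℝ (Fin n)) ℝ,
      ContinuousOn g (closure Ω \ {0}) ∧ ∀ x ∈ Ω \ {0}, g x = iteratedFDeriv ℝ k u x

/-- Global Lipschitz continuity on `[0, ∞)`, `f(0) ≥ 0`, and monotonicity. -/
structure IsAdmissibleNonlinearity (f : ℝ → ℝ) : Prop where
  lipschitz : ∃ K : NNReal, LipschitzOnWith K f (Ici 0)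
  zero_nonneg : 0 ≤ f 0
  monotone : MonotoneOn f (Ici 0)

/-- `u ∈ C^{2m}(Ω ∖ {0}) ∩ C^{2m-2}(Ω̄ ∖ {0})` is a positive classical solution of
`∑ₖ s_k(α) (-Δ)^k u = f(u)` in `Ω ∖ {0}` with Navier boundary conditions
`u = -Δu = ⋯ = (-Δ)^{m-1}u = 0` on `∂Ω` and with `(-Δ)^j u` bounded below for `1 ≤ j ≤ m - 1`.
The value on `∂Ω` of `(-Δ)^j u` is the one of its continuous extension, i.e. its limit. -/
structure IsPositiveNavierSolution {n m : ℕ} (α : Fin m → ℝ) (f : ℝ → ℝ)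
    (Ω : Set (EuclideanSpace ℝ (Fin n))) (u : EuclideanSpace ℝ (Fin n) → ℝ) : Prop where
  contDiffOn : ContDiffOn ℝ ((2 * m : ℕ) : WithTop ℕ∞) u (Ω \ {0})
  upToBoundary : IsCrUpToBoundary (2 * m - 2) Ω u
  equation : ∀ x ∈ Ω \ {0},
    ∑ k ∈ Finset.range (m + 1), symmCoeff α k * negLaplacianPow k u x = f (u x)
  pos : ∀ x ∈ Ω \ {0}, 0 < u x
  navier : ∀ j < m, ∀ y ∈ frontier Ω, Tendsto (negLaplacianPow j u) (𝓝[Ω \ {0}] y) (𝓝 0)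
  boundedBelow : ∀ j, 1 ≤ j → j < m → BddBelow (negLaplacianPow j u '' (Ω \ {0}))

/-!
Nonnegativity of the `s_k(α)` forces every `αᵢ` to be nonnegative, so that the equation
`∏ (-Δ + αᵢ) u = f(u)` is a chain of second-order equations `-ΔUᵢ + αᵢUᵢ = Uᵢ₊₁` closed up by
`U_m = f(U₀)`. The system is cooperative because `f` is nondecreasing, and the method of moving
planes applies to all the `Uᵢ` at once: their increments under reflection across `{x₁ = c}` satisfy
a linear cooperative chain on the cap `{x₁ > c}`. The Aleksandrov-Bakelman-Pucci estimate gives a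
maximum principle for such chains in domains of small volume. The origin and its mirror image do not
matter, since the `Uᵢ` are bounded below and points have zero capacity: a small multiple of a
logarithmic barrier may be added. The strong minimum principle makes the increments strictly
positive: if one of them vanished somewhere, it would vanish all the way along a line parallel to
the `x₁`-axis to the boundary, where `u` is zero while its mirror value is positive.
-/

open MeasureTheory Metric
open scoped Laplacian Gradient InnerProductSpace

theorem deriv_deriv_nonneg_of_isLocalMin {g : ℝ → ℝ} {a : ℝ} (hg : IsLocalMin g a)
    (hc : ContinuousAt g a) : 0 ≤ deriv (deriv g) a := by
  by_contra! hneg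
  have hmax : IsLocalMax g a := isLocalMax_of_deriv_deriv_neg hneg hg.deriv_eq_zero hc
  have hconst : g =ᶠ[𝓝 a] fun _ => g a := by
    filter_upwards [hg, hmax] with t h₁ h₂ using le_antisymm h₂ h₁
  rw [hconst.deriv.deriv_eq] at hneg
  simp at hneg

section Hessian

variable {E : Type*} [NormedAddCommGroup E] [NormedSpace ℝ E] {f : E → ℝ} {x : E}

theorem deriv_deriv_comp_line (hf : ContDiffAt ℝ 2 f x) (v : E) :
    deriv (deriv fun t : ℝ => f (x + t • v)) 0 = fderiv ℝ (fderiv ℝ f) x v v := by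
  have hline (t : ℝ) : HasDerivAt (fun t : ℝ => x + t • v) v t := by
    simpa using ((hasDerivAt_id t).smul_const v).const_add x
  have hlim : Tendsto (fun t : ℝ => x + t • v) (𝓝 0) (𝓝 x) := by
    simpa using (hline 0).continuousAt.tendsto
  have hdiff : ∀ᶠ y in 𝓝 x, DifferentiableAt ℝ f y :=
    (hf.eventually (by simp)).mono fun y hy => hy.differentiableAt (by norm_num)
  have hfirst : (deriv fun t : ℝ => f (x + t • v)) =ᶠ[𝓝 0] fun t => fderiv ℝ f (x + t • v) v :=
    (hlim.eventually hdiff).mono fun t ht => (ht.hasFDerivAt.comp_hasDerivAt t (hline t)).deriv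
  have hsecond : HasFDerivAt (fderiv ℝ f) (fderiv ℝ (fderiv ℝ f) x) (x + (0 : ℝ) • v) := by
    have h := (hf.fderiv_right (m := 1) (by norm_num)).differentiableAt (by norm_num)
    simpa using h.hasFDerivAt
  have hline' := hsecond.comp_hasDerivAt 0 (hline 0)
  rw [hfirst.deriv_eq]
  simpa using (hline'.clm_apply (hasDerivAt_const 0 v)).deriv

theorem fderiv_fderiv_nonneg_of_isLocalMin (hf : ContDiffAt ℝ 2 f x) (hmin : IsLocalMin f x)
    (v : E) : 0 ≤ fderiv ℝ (fderiv ℝ f) x v v := by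
  have hline : ContinuousAt (fun t : ℝ => x + t • v) 0 := by fun_prop
  rw [← deriv_deriv_comp_line hf v]
  refine deriv_deriv_nonneg_of_isLocalMin ?_ (hf.continuousAt.comp_of_eq hline (by simp))
  have hlim : Tendsto (fun t : ℝ => x + t • v) (𝓝 0) (𝓝 x) := by simpa using hline.tendsto
  filter_upwards [hlim.eventually hmin] with t ht
  simpa using ht

end Hessian

section Laplacian

variable {E : Type*} [NormedAddCommGroup E] [InnerProductSpace ℝ E] [FiniteDimensional ℝ E]

theorem laplacian_eq_sum_fderiv_fderiv {ι : Type*} [Fintype ι] (b : OrthonormalBasis ι ℝ E)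
    (f : E → ℝ) (x : E) : Δ f x = ∑ i, fderiv ℝ (fderiv ℝ f) x (b i) (b i) := by
  rw [InnerProductSpace.laplacian_eq_iteratedFDeriv_orthonormalBasis f b]
  simp [iteratedFDeriv_two_apply]

theorem laplacian_nonneg_of_forall_fderiv_fderiv_nonneg {f : E → ℝ} {x : E}
    (hf : ∀ v, 0 ≤ fderiv ℝ (fderiv ℝ f) x v v) : 0 ≤ Δ f x := by
  rw [laplacian_eq_sum_fderiv_fderiv (stdOrthonormalBasis ℝ E)]
  exact Finset.sum_nonneg fun i _ => hf _

theorem contDiffOn_laplacian {f : E → ℝ} {s : Set E} (hs : IsOpen s) {k : ℕ}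
    (hf : ContDiffOn ℝ (k + 2 : ℕ) f s) : ContDiffOn ℝ k (Δ f) s := by
  have hfirst : ContDiffOn ℝ (k + 1 : ℕ) (fderiv ℝ f) s :=
    hf.fderiv_of_isOpen hs (by norm_cast)
  have hsecond : ContDiffOn ℝ k (fderiv ℝ (fderiv ℝ f)) s :=
    hfirst.fderiv_of_isOpen hs (by norm_cast)
  rw [funext (laplacian_eq_sum_fderiv_fderiv (stdOrthonormalBasis ℝ E) f)]
  exact ContDiffOn.sum fun i _ => (hsecond.clm_apply contDiffOn_const).clm_apply contDiffOn_const

theorem laplacian_comp_isometry_add (f : E → ℝ) (L : E ≃ₗᵢ[ℝ] E) (c x : E) :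
    Δ (fun y => f (L y + c)) x = Δ f (L x + c) := by
  have hcomp : iteratedFDeriv ℝ 2 ((fun y => f (y + c)) ∘ L) x =
      (iteratedFDeriv ℝ 2 f (L x + c)).compContinuousLinearMap
        fun _ => L.toContinuousLinearEquiv := by
    simp only [← iteratedFDerivWithin_univ]
    refine (L.toContinuousLinearEquiv.iteratedFDerivWithin_comp_right (fun y => f (y + c))
      uniqueDiffOn_univ (mem_univ _) 2).trans ?_
    rw [iteratedFDerivWithin_comp_add_right, vadd_set_univ]
    rfl
  change Δ ((fun y => f (y + c)) ∘ L) x = Δ f (L x + c)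
  rw [InnerProductSpace.laplacian_eq_iteratedFDeriv_stdOrthonormalBasis,
    InnerProductSpace.laplacian_eq_iteratedFDeriv_orthonormalBasis f
      ((stdOrthonormalBasis ℝ E).map L)]
  beta_reduce
  rw [hcomp]
  simp [iteratedFDeriv_two_apply]

theorem abs_det_le_trace_pow {T : E →ₗ[ℝ] E} (hT : T.IsSymmetric)
    (hpos : ∀ v, 0 ≤ ⟪T v, v⟫_ℝ) :
    |LinearMap.det T| ≤ (LinearMap.trace ℝ E T) ^ Module.finrank ℝ E := by
  have hev (i) : 0 ≤ hT.eigenvalues rfl i := by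
    have h := hpos (hT.eigenvectorBasis rfl i)
    rw [hT.apply_eigenvectorBasis rfl i] at h
    simpa [inner_smul_left] using h
  have hdet := hT.det_eq_prod_eigenvalues rfl
  have htr := hT.trace_eq_sum_eigenvalues rfl
  simp only [RCLike.ofReal_real_eq_id, id_eq] at hdet htr
  rw [hdet, htr, abs_of_nonneg (Finset.prod_nonneg fun i _ => hev i)]
  calc ∏ i, hT.eigenvalues rfl i ≤ ∏ _i : Fin (Module.finrank ℝ E), ∑ j, hT.eigenvalues rfl j :=
        Finset.prod_le_prod (fun i _ => hev i) fun i _ =>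
          Finset.single_le_sum (fun j _ => hev j) (Finset.mem_univ i)
    _ = (∑ i, hT.eigenvalues rfl i) ^ Module.finrank ℝ E := by simp

variable {f : E → ℝ} {x : E}

theorem hasFDerivAt_gradient (hf : ContDiffAt ℝ 2 f x) :
    HasFDerivAt (∇ f) (fderiv ℝ (∇ f) x) x := by
  have h := (hf.fderiv_right (m := 1) (by norm_num)).differentiableAt (by norm_num)
  exact ((InnerProductSpace.toDual ℝ E).symm.differentiable.differentiableAt.comp x h).hasFDerivAt

theorem inner_fderiv_gradient (v w : E) :
    ⟪fderiv ℝ (∇ f) x v, w⟫_ℝ = fderiv ℝ (fderiv ℝ f) x v w := by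
  have h : fderiv ℝ (∇ f) x = _ :=
    (InnerProductSpace.toDual ℝ E).symm.toContinuousLinearEquiv.comp_fderiv (f := fderiv ℝ f)
  simp [h]

theorem abs_det_fderiv_gradient_le (hf : ContDiffAt ℝ 2 f x)
    (hpos : ∀ v, 0 ≤ fderiv ℝ (fderiv ℝ f) x v v) :
    |(fderiv ℝ (∇ f) x).det| ≤ (Δ f x) ^ Module.finrank ℝ E := by
  have hsymm : (fderiv ℝ (∇ f) x : E →ₗ[ℝ] E).IsSymmetric := fun v w => by
    change ⟪fderiv ℝ (∇ f) x v, w⟫_ℝ = ⟪v, fderiv ℝ (∇ f) x w⟫_ℝ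
    rw [inner_fderiv_gradient, real_inner_comm, inner_fderiv_gradient,
      (hf.isSymmSndFDerivAt (by simp)).eq v w]
  have htrace : LinearMap.trace ℝ E (fderiv ℝ (∇ f) x : E →ₗ[ℝ] E) = Δ f x := by
    rw [LinearMap.trace_eq_sum_inner _ (stdOrthonormalBasis ℝ E),
      laplacian_eq_sum_fderiv_fderiv (stdOrthonormalBasis ℝ E)]
    refine Finset.sum_congr rfl fun i _ => ?_
    rw [real_inner_comm, ← inner_fderiv_gradient]
    rfl
  exact htrace ▸ abs_det_le_trace_pow hsymm fun v => (inner_fderiv_gradient v v).symm ▸ hpos v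

end Laplacian

/-- `0 ≤ liminf w` along `l`. Unlike with `Filter.liminf`, a real-valued function that
tends to `+∞` satisfies it. -/
def LiminfNonneg {X : Type*} (w : X → ℝ) (l : Filter X) : Prop :=
  ∀ ε > 0, ∀ᶠ x in l, -ε < w x

namespace LiminfNonneg

variable {X : Type*} {w : X → ℝ} {l l' : Filter X}

theorem of_tendsto {b : ℝ} (h : Tendsto w l (𝓝 b)) (hb : 0 ≤ b) : LiminfNonneg w l :=
  fun _ hε => h.eventually (lt_mem_nhds (by linarith))

theorem of_eventually_nonneg (h : ∀ᶠ x in l, 0 ≤ w x) : LiminfNonneg w l :=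
  fun _ hε => h.mono fun _ hx => (neg_lt_zero.2 hε).trans_le hx

theorem mono (h : LiminfNonneg w l) (hl : l' ≤ l) : LiminfNonneg w l' :=
  fun ε hε => hl (h ε hε)

end LiminfNonneg

theorem exists_isLocalMin_of_lt_frontier {X : Type*} [PseudoMetricSpace X] [ProperSpace X]
    {D : Set X} {h : X → ℝ} (hD : IsOpen D) (hDb : Bornology.IsBounded D) (hc : ContinuousOn h D)
    {x₀ : X} (hx₀ : x₀ ∈ D) (hbd : ∀ y ∈ frontier D, ∀ᶠ x in 𝓝[D] y, h x₀ < h x) :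
    ∃ x ∈ D, h x ≤ h x₀ ∧ IsLocalMin h x := by
  set S : Set X := {x ∈ D | h x ≤ h x₀}
  have hSclosed : IsClosed S := isClosed_of_closure_subset fun y hy => by
    have hfreq : ∃ᶠ x in 𝓝[D] y, h x ≤ h x₀ :=
      frequently_nhdsWithin_iff.2 ((mem_closure_iff_frequently.1 hy).mono fun x hx => hx.symm)
    have hyD : y ∈ D := by
      by_contra hyD
      have hyf : y ∈ frontier D := ⟨closure_mono (sep_subset D _) hy, by rwa [hD.interior_eq]⟩
      exact hfreq ((hbd y hyf).mono fun x hx => hx.not_ge)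
    exact ⟨hyD, not_lt.1 fun hlt =>
      hfreq (((hc y hyD).eventually (lt_mem_nhds hlt)).mono fun x hx => hx.not_ge)⟩
  have hScompact : IsCompact S :=
    isCompact_of_isClosed_isBounded hSclosed (hDb.subset (sep_subset D _))
  obtain ⟨x, ⟨hxD, hxx₀⟩, hxmin⟩ :=
    hScompact.exists_isMinOn ⟨x₀, hx₀, le_rfl⟩ (hc.mono (sep_subset D _))
  refine ⟨x, hxD, hxx₀, ?_⟩
  filter_upwards [hD.mem_nhds hxD] with y hy
  by_cases hyx₀ : h y ≤ h x₀
  · exact hxmin ⟨hy, hyx₀⟩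
  · exact hxx₀.trans (not_le.1 hyx₀).le

section ABP

variable {E : Type*} [NormedAddCommGroup E] [InnerProductSpace ℝ E]

/-- The points of `D` at which `w` is negative and its Hessian is positive semidefinite. This set
contains the lower contact set of the negative part of `w` in the Aleksandrov–Bakelman–Pucci
argument. -/
def contactSet (D : Set E) (w : E → ℝ) : Set E :=
  {x ∈ D | w x < 0 ∧ ∀ v, 0 ≤ fderiv ℝ (fderiv ℝ w) x v v}

variable {D : Set E} {w : E → ℝ}

theorem measurableSet_contactSet [MeasurableSpace E] [BorelSpace E] (hD : IsOpen D)
    (hw : ContDiffOn ℝ 2 w D) :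
    MeasurableSet (contactSet D w) := by
  have hneg : MeasurableSet (D ∩ w ⁻¹' Iio 0) :=
    (hw.continuousOn.isOpen_inter_preimage hD isOpen_Iio).measurableSet
  have hclosed : IsClosed {B : E →L[ℝ] E →L[ℝ] ℝ | ∀ v, 0 ≤ B v v} := by
    simp only [ofPred_forall]
    exact isClosed_iInter fun v => isClosed_le continuous_const (by fun_prop)
  have hcont : ContinuousOn (fderiv ℝ (fderiv ℝ w)) D :=
    (hw.fderiv_of_isOpen hD (m := 1) (by norm_num)).continuousOn_fderiv_of_isOpen hD le_rfl
  obtain ⟨C, hC, hCeq⟩ := continuousOn_iff_isClosed.1 hcont _ hclosed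
  have hpos : MeasurableSet (fderiv ℝ (fderiv ℝ w) ⁻¹' {B | ∀ v, 0 ≤ B v v} ∩ D) :=
    hCeq ▸ hC.measurableSet.inter hD.measurableSet
  convert hneg.inter hpos using 1
  ext x
  simp only [contactSet, mem_ofPred_eq, mem_inter_iff, mem_preimage, mem_Iio]
  tauto

variable [FiniteDimensional ℝ E]

theorem ball_subset_gradient_image_contactSet (hD : IsOpen D) (hDb : Bornology.IsBounded D)
    (hw : ContDiffOn ℝ 2 w D) (hbd : ∀ y ∈ frontier D, LiminfNonneg w (𝓝[D] y))
    {x₀ : E} (hx₀ : x₀ ∈ D) {r : ℝ} (hr : r * diam D < -w x₀) :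
    ball 0 r ⊆ ∇ w '' contactSet D w := by
  intro p hp
  set ℓ : E →L[ℝ] ℝ := innerSL ℝ p
  have hℓbound : ∀ x ∈ D, ℓ (x - x₀) ≤ r * diam D := fun x hx =>
    calc ℓ (x - x₀) ≤ ‖p‖ * ‖x - x₀‖ := real_inner_le_norm p (x - x₀)
      _ ≤ r * diam D := by
        rw [← dist_eq_norm]
        have := mem_ball_zero_iff.1 hp
        gcongr
        · exact (norm_nonneg p).trans this.le
        · exact dist_le_diam_of_mem hDb hx hx₀
  set h : E → ℝ := fun x => w x - ℓ (x - x₀) with hh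
  have hhw : ContDiffOn ℝ 2 h D := hw.sub (by fun_prop)
  have hh₀ : h x₀ = w x₀ := by simp [hh]
  obtain ⟨x, hxD, hxx₀, hmin⟩ : ∃ x ∈ D, h x ≤ h x₀ ∧ IsLocalMin h x := by
    refine exists_isLocalMin_of_lt_frontier hD hDb hhw.continuousOn hx₀ fun y hy => ?_
    filter_upwards [hbd y hy (-w x₀ - r * diam D) (by linarith), self_mem_nhdsWithin] with x hx hxD
    linarith [hℓbound x hxD]
  have hfderiv : ∀ y ∈ D, fderiv ℝ h y = fderiv ℝ w y - ℓ := fun y hy =>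
    ((((hw.contDiffAt (hD.mem_nhds hy)).differentiableAt (by norm_num)).hasFDerivAt).sub
      (ℓ.hasFDerivAt.comp y ((hasFDerivAt_id y).sub_const x₀))).fderiv
  have hfderiv' : fderiv ℝ h =ᶠ[𝓝 x] fun y => fderiv ℝ w y - ℓ :=
    eventually_of_mem (hD.mem_nhds hxD) hfderiv
  have hgrad : fderiv ℝ w x = ℓ := sub_eq_zero.1 (hfderiv x hxD ▸ hmin.fderiv_eq_zero)
  refine ⟨x, ⟨hxD, by linarith [hℓbound x hxD], fun v => ?_⟩, ?_⟩
  · have := fderiv_fderiv_nonneg_of_isLocalMin (hhw.contDiffAt (hD.mem_nhds hxD)) hmin v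
    rwa [hfderiv'.fderiv_eq, fderiv_sub_const] at this
  · rw [gradient, hgrad]
    exact (InnerProductSpace.toDual ℝ E).symm_apply_apply p

variable [MeasurableSpace E] [BorelSpace E]

theorem volume_ball_le_lintegral_contactSet (hD : IsOpen D) (hDb : Bornology.IsBounded D)
    (hw : ContDiffOn ℝ 2 w D) (hbd : ∀ y ∈ frontier D, LiminfNonneg w (𝓝[D] y))
    {x₀ : E} (hx₀ : x₀ ∈ D) {r : ℝ} (hr : r * diam D < -w x₀) :
    volume (ball (0 : E) r) ≤
      ∫⁻ x in contactSet D w, ENNReal.ofReal ((Δ w x) ^ Module.finrank ℝ E) := by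
  have hmeas := measurableSet_contactSet hD hw
  have hcd : ∀ x ∈ contactSet D w, ContDiffAt ℝ 2 w x := fun x hx =>
    hw.contDiffAt (hD.mem_nhds hx.1)
  calc volume (ball (0 : E) r) ≤ volume (∇ w '' contactSet D w) :=
        measure_mono (ball_subset_gradient_image_contactSet hD hDb hw hbd hx₀ hr)
    _ ≤ ∫⁻ x in contactSet D w, ENNReal.ofReal |(fderiv ℝ (∇ w) x).det| :=
        addHaar_image_le_lintegral_abs_det_fderiv _ hmeas fun x hx =>
          (hasFDerivAt_gradient (hcd x hx)).hasFDerivWithinAt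
    _ ≤ ∫⁻ x in contactSet D w, ENNReal.ofReal ((Δ w x) ^ Module.finrank ℝ E) :=
        setLIntegral_mono' hmeas fun x hx =>
          ENNReal.ofReal_le_ofReal (abs_det_fderiv_gradient_le (hcd x hx) hx.2.2)

theorem le_of_volume_ball_le [Nontrivial E] {r s : ℝ} (hr : 0 < r) (hs : 0 ≤ s)
    (h : volume (ball (0 : E) r) ≤ volume (ball (0 : E) s)) : r ≤ s := by
  have hpos : volume (ball (0 : E) 1) ≠ 0 := (measure_ball_pos volume 0 one_pos).ne'
  rw [Measure.addHaar_ball _ _ hr.le, Measure.addHaar_ball _ _ hs,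
    ENNReal.mul_le_mul_iff_left hpos measure_ball_lt_top.ne,
    ENNReal.ofReal_le_ofReal_iff (by positivity)] at h
  exact le_of_pow_le_pow_left₀ Module.finrank_pos.ne' hs h

theorem abp_estimate [Nontrivial E] {A : Set E} {θ K : ℝ} (hD : IsOpen D)
    (hDb : Bornology.IsBounded D) (hw : ContDiffOn ℝ 2 w D)
    (hbd : ∀ y ∈ frontier D, LiminfNonneg w (𝓝[D] y)) (hK : 0 ≤ K) (hθ : 0 ≤ θ)
    (hA : volume A ≤ volume (ball (0 : E) θ))
    (hlap : ∀ x ∈ D, w x < 0 → Δ w x ≤ A.indicator (fun _ => K) x) :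
    ∀ x ∈ D, -(K * θ * diam D) ≤ w x := by
  intro x₀ hx₀
  by_contra! hlt
  obtain ⟨r, hr, hrlt⟩ : ∃ r, r * diam D < -w x₀ ∧ K * θ < r := by
    have hcont : ContinuousAt (fun r : ℝ => r * diam D) (K * θ) := by fun_prop
    have hev := hcont.eventually (gt_mem_nhds (show K * θ * diam D < -w x₀ by linarith))
    exact ((hev.filter_mono nhdsWithin_le_nhds).and (self_mem_nhdsWithin (s := Ioi (K * θ)))).exists
  have hint : ∀ x ∈ contactSet D w, ENNReal.ofReal ((Δ w x) ^ Module.finrank ℝ E) ≤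
      A.indicator (fun _ => ENNReal.ofReal (K ^ Module.finrank ℝ E)) x := fun x hx => by
    have hΔ := laplacian_nonneg_of_forall_fderiv_fderiv_nonneg hx.2.2
    have hΔK := hlap x hx.1 hx.2.1
    by_cases hxA : x ∈ A
    · rw [indicator_of_mem hxA] at hΔK ⊢
      gcongr
    · rw [indicator_of_notMem hxA] at hΔK ⊢
      rw [le_antisymm hΔK hΔ, zero_pow Module.finrank_pos.ne', ENNReal.ofReal_zero]
  have hvol : volume (ball (0 : E) r) ≤ volume (ball (0 : E) (K * θ)) :=
    calc volume (ball (0 : E) r)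
        ≤ ∫⁻ x in contactSet D w, ENNReal.ofReal ((Δ w x) ^ Module.finrank ℝ E) :=
          volume_ball_le_lintegral_contactSet hD hDb hw hbd hx₀ hr
      _ ≤ ∫⁻ x in contactSet D w,
            A.indicator (fun _ => ENNReal.ofReal (K ^ Module.finrank ℝ E)) x :=
          setLIntegral_mono' (measurableSet_contactSet hD hw) hint
      _ ≤ ENNReal.ofReal (K ^ Module.finrank ℝ E) * volume A :=
          (setLIntegral_le_lintegral _ _).trans (lintegral_indicator_const_le _ _)
      _ ≤ ENNReal.ofReal (K ^ Module.finrank ℝ E) * volume (ball (0 : E) θ) := by gcongr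
      _ = volume (ball (0 : E) (K * θ)) := (Measure.addHaar_ball_mul _ _ hK θ).symm
  have hKθ : 0 ≤ K * θ := mul_nonneg hK hθ
  exact hrlt.not_ge (le_of_volume_ball_le (hKθ.trans_lt hrlt) hKθ hvol)

end ABP

section Radial

variable {E : Type*} [NormedAddCommGroup E] [InnerProductSpace ℝ E]

theorem hasFDerivAt_norm_sub_sq (x z : E) :
    HasFDerivAt (fun y : E => ‖y - z‖ ^ 2) ((2 : ℝ) • innerSL ℝ (x - z)) x := by
  have h := ((hasStrictFDerivAt_norm_sq (x - z)).hasFDerivAt).comp x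
    ((hasFDerivAt_id x).sub_const z)
  exact h.congr_fderiv (by ext v; simp)

theorem laplacian_radial [FiniteDimensional ℝ E] {φ φ' : ℝ → ℝ} {φ'' : ℝ} {x z : E}
    (hφ : ∀ᶠ s in 𝓝 (‖x - z‖ ^ 2), HasDerivAt φ (φ' s) s)
    (hφ' : HasDerivAt φ' φ'' (‖x - z‖ ^ 2)) :
    Δ (fun y : E => φ (‖y - z‖ ^ 2)) x =
      4 * φ'' * ‖x - z‖ ^ 2 + 2 * Module.finrank ℝ E * φ' (‖x - z‖ ^ 2) := by
  set I : E →L[ℝ] E →L[ℝ] ℝ := (2 : ℝ) • (innerSL ℝ : E →L[ℝ] E →L[ℝ] ℝ)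
  have hIv (v w : E) : I v w = 2 * ⟪v, w⟫_ℝ := rfl
  have hfirst : fderiv ℝ (fun y : E => φ (‖y - z‖ ^ 2)) =ᶠ[𝓝 x]
      fun y => φ' (‖y - z‖ ^ 2) • I (y - z) := by
    filter_upwards [(hasFDerivAt_norm_sub_sq x z).continuousAt.eventually hφ] with y hy
    exact (hy.comp_hasFDerivAt y (hasFDerivAt_norm_sub_sq y z)).fderiv
  have hsecond : HasFDerivAt (fun y => φ' (‖y - z‖ ^ 2) • I (y - z))
      (φ' (‖x - z‖ ^ 2) • I + (φ'' • I (x - z)).smulRight (I (x - z))) x :=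
    (hφ'.comp_hasFDerivAt x (hasFDerivAt_norm_sub_sq x z)).smul
      (I.hasFDerivAt.comp x ((hasFDerivAt_id x).sub_const z))
  set b := stdOrthonormalBasis ℝ E
  have hterm (i) : (φ' (‖x - z‖ ^ 2) • I + (φ'' • I (x - z)).smulRight (I (x - z))) (b i) (b i) =
      2 * φ' (‖x - z‖ ^ 2) + 4 * φ'' * ⟪x - z, b i⟫_ℝ ^ 2 := by
    have hbi : ⟪b i, b i⟫_ℝ = 1 := by simp
    simp only [add_apply, smul_apply, ContinuousLinearMap.smulRight_apply, hIv, smul_eq_mul, hbi]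
    ring
  have hParseval : ∑ i, ⟪x - z, b i⟫_ℝ ^ 2 = ‖x - z‖ ^ 2 := by
    simpa using b.sum_sq_norm_inner_left (x - z)
  rw [laplacian_eq_sum_fderiv_fderiv b, hfirst.fderiv_eq, hsecond.fderiv]
  simp only [hterm, Finset.sum_add_distrib, ← Finset.mul_sum, hParseval]
  simp
  ring

end Radial

theorem norm_sub_sq_pos {E : Type*} [NormedAddCommGroup E] {x z : E} (hx : x ≠ z) :
    0 < ‖x - z‖ ^ 2 :=
  pow_pos (norm_pos_iff.2 (sub_ne_zero.2 hx)) 2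

section Pole

variable {E : Type*} [NormedAddCommGroup E]

/-- The function `log (r² / |x - z|²)`. In dimension at least two it is superharmonic, and its pole
shows that points have zero capacity. Its value at `z` itself is the junk value `log (r²)`. -/
noncomputable def logBarrier (z : E) (r : ℝ) (x : E) : ℝ :=
  Real.log (r ^ 2) - Real.log (‖x - z‖ ^ 2)

variable {z x : E} {r : ℝ}

theorem logBarrier_nonneg (hx : x ≠ z) (hxr : x ∈ closedBall z r) : 0 ≤ logBarrier z r x := by
  rw [mem_closedBall, dist_eq_norm] at hxr
  exact sub_nonneg.2 (Real.log_le_log (norm_sub_sq_pos hx) (by gcongr))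

theorem tendsto_logBarrier : Tendsto (logBarrier z r) (𝓝[≠] z) atTop := by
  have hnorm : Tendsto (fun x : E => ‖x - z‖ ^ 2) (𝓝[≠] z) (𝓝[≠] 0) := by
    refine tendsto_nhdsWithin_iff.2 ⟨?_, ?_⟩
    · have hc : Continuous fun x : E => ‖x - z‖ ^ 2 := by fun_prop
      simpa using (hc.tendsto z).mono_left nhdsWithin_le_nhds
    · filter_upwards [self_mem_nhdsWithin] with x hx using (norm_sub_sq_pos hx).ne'
  exact tendsto_atTop_add_const_left _ _
    (tendsto_neg_atBot_atTop.comp (Real.tendsto_log_nhdsNE_zero.comp hnorm))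

theorem liminfNonneg_add_logBarrier {D : Set E} {w : E → ℝ} {δ : ℝ} (hz : z ∉ D)
    (hwb : BddBelow (w '' D)) (hδ : 0 < δ) : LiminfNonneg (w + δ • logBarrier z r) (𝓝[D] z) := by
  obtain ⟨b, hb⟩ := hwb
  have hsub : 𝓝[D] z ≤ 𝓝[≠] z := nhdsWithin_mono _ fun x hx h => hz (h ▸ hx)
  refine .of_eventually_nonneg ?_
  filter_upwards [hsub (tendsto_logBarrier.eventually_ge_atTop (-b / δ)), self_mem_nhdsWithin]
    with x hx hxD
  have hδg : -b ≤ δ * logBarrier z r x := (div_le_iff₀' hδ).1 hx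
  have hbx : b ≤ w x := hb (mem_image_of_mem w hxD)
  simp only [Pi.add_apply, Pi.smul_apply, smul_eq_mul]
  linarith

variable [InnerProductSpace ℝ E]

theorem contDiffOn_logBarrier : ContDiffOn ℝ 2 (logBarrier z r) {z}ᶜ := by
  refine contDiffOn_const.sub (ContDiffOn.log ?_ fun x hx => (norm_sub_sq_pos hx).ne')
  exact ((contDiff_id.sub contDiff_const).norm_sq ℝ).contDiffOn

variable [FiniteDimensional ℝ E]

theorem laplacian_logBarrier_nonpos (hdim : 2 ≤ Module.finrank ℝ E) (hx : x ≠ z) :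
    Δ (logBarrier z r) x ≤ 0 := by
  have hs := norm_sub_sq_pos hx
  have hdim' : (2 : ℝ) ≤ Module.finrank ℝ E := by exact_mod_cast hdim
  have hradial := laplacian_radial (φ := fun s => Real.log (r ^ 2) - Real.log s)
    (φ' := fun s => -s⁻¹) (φ'' := ((‖x - z‖ ^ 2) ^ 2)⁻¹)
    ((lt_mem_nhds hs).mono fun s hs => (Real.hasDerivAt_log hs.ne').const_sub _)
    ((hasDerivAt_inv hs.ne').neg.congr_deriv (neg_neg _))
  calc Δ (logBarrier z r) x
      = 4 * ((‖x - z‖ ^ 2) ^ 2)⁻¹ * ‖x - z‖ ^ 2 +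
          2 * Module.finrank ℝ E * -(‖x - z‖ ^ 2)⁻¹ := hradial
    _ = -(2 * (Module.finrank ℝ E - 2) * (‖x - z‖ ^ 2)⁻¹) := by field_simp; ring
    _ ≤ 0 := by
        have : 0 ≤ (Module.finrank ℝ E : ℝ) - 2 := sub_nonneg.2 hdim'
        exact neg_nonpos.2 (by positivity)

variable [MeasurableSpace E] [BorelSpace E] {D A : Set E} {w : E → ℝ} {θ K : ℝ}

/-- The function is not controlled at the puncture `z`: adding `δ` times the logarithmic barrier
makes it tend to `+∞` there, and `δ → 0`. -/
theorem abp_estimate_of_pole (hdim : 2 ≤ Module.finrank ℝ E) (hD : IsOpen D) (hz : z ∉ D)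
    (hDb : Bornology.IsBounded D) (hw : ContDiffOn ℝ 2 w D) (hwb : BddBelow (w '' D))
    (hbd : ∀ y ∈ frontier D, y ≠ z → LiminfNonneg w (𝓝[D] y)) (hK : 0 ≤ K) (hθ : 0 ≤ θ)
    (hA : volume A ≤ volume (ball (0 : E) θ))
    (hlap : ∀ x ∈ D, w x < 0 → Δ w x ≤ A.indicator (fun _ => K) x) :
    ∀ x ∈ D, -(K * θ * diam D) ≤ w x := by
  have : Nontrivial E := Module.nontrivial_of_finrank_pos (R := ℝ) (by omega)
  obtain ⟨r, hr⟩ := hDb.subset_closedBall z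
  set g := logBarrier z r
  have hne : ∀ x ∈ D, x ≠ z := fun x hx h => hz (h ▸ hx)
  have hg : ContDiffOn ℝ 2 g D := contDiffOn_logBarrier.mono hne
  have hperturbed : ∀ δ > 0, ∀ x ∈ D, -(K * θ * diam D) ≤ w x + δ * g x := by
    intro δ hδ
    have hle : ∀ x ∈ D, w x ≤ w x + δ * g x := fun x hx =>
      le_add_of_nonneg_right (mul_nonneg hδ.le (logBarrier_nonneg (hne x hx) (hr hx)))
    have hΔ : ∀ x ∈ D, Δ (w + δ • g) x ≤ Δ w x := fun x hx => by
      have hgx : ContDiffAt ℝ 2 g x := hg.contDiffAt (hD.mem_nhds hx)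
      have hδgx : ContDiffAt ℝ 2 (δ • g) x := hgx.const_smul δ
      rw [(hw.contDiffAt (hD.mem_nhds hx)).laplacian_add hδgx,
        InnerProductSpace.laplacian_smul δ hgx]
      exact add_le_of_nonpos_right
        (mul_nonpos_of_nonneg_of_nonpos hδ.le (laplacian_logBarrier_nonpos hdim (hne x hx)))
    refine abp_estimate hD hDb (hw.add (hg.const_smul δ)) (fun y hy => ?_) hK hθ hA
      fun x hx hneg => (hΔ x hx).trans (hlap x hx ((hle x hx).trans_lt hneg))
    obtain rfl | hyz := eq_or_ne y z
    · exact liminfNonneg_add_logBarrier hz hwb hδ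
    · intro ε hε
      filter_upwards [hbd y hy hyz ε hε, self_mem_nhdsWithin] with x hx hxD
      exact hx.trans_le (hle x hxD)
  intro x hx
  have hlim : Tendsto (fun δ : ℝ => w x + δ * g x) (𝓝[>] 0) (𝓝 (w x + 0 * g x)) :=
    ((by fun_prop : Continuous fun δ : ℝ => w x + δ * g x).tendsto 0).mono_left nhdsWithin_le_nhds
  simpa using ge_of_tendsto hlim (eventually_mem_nhdsWithin.mono fun δ hδ => hperturbed δ hδ x hx)

theorem nonneg_of_laplacian_nonpos [Nontrivial E] (hD : IsOpen D) (hDb : Bornology.IsBounded D)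
    (hw : ContDiffOn ℝ 2 w D) (hbd : ∀ y ∈ frontier D, LiminfNonneg w (𝓝[D] y))
    (hlap : ∀ x ∈ D, w x < 0 → Δ w x ≤ 0) : ∀ x ∈ D, 0 ≤ w x := by
  simpa using abp_estimate (A := ∅) hD hDb hw hbd le_rfl le_rfl (by simp) (by simpa using hlap)

end Pole

section StrongMinimumPrinciple

variable {E : Type*} [NormedAddCommGroup E]

/-- Hopf's barrier on an annulus with centre `z` and outer radius `R`. -/
noncomputable def hopfBarrier (β R : ℝ) (z x : E) : ℝ :=
  Real.exp (-β * ‖x - z‖ ^ 2) - Real.exp (-β * R ^ 2)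

variable {β R a : ℝ} {z x₁ : E}

theorem hopfBarrier_of_dist_eq {x : E} (hx : dist x z = R) : hopfBarrier β R z x = 0 := by
  rw [hopfBarrier, ← dist_eq_norm, hx, sub_self]

theorem hopfBarrier_le_one (hβ : 0 ≤ β) (x : E) : hopfBarrier β R z x ≤ 1 := by
  have h₁ : Real.exp (-β * ‖x - z‖ ^ 2) ≤ 1 :=
    Real.exp_le_one_iff.2 (mul_nonpos_of_nonpos_of_nonneg (neg_nonpos.2 hβ) (sq_nonneg _))
  have h₂ : 0 < Real.exp (-β * R ^ 2) := Real.exp_pos _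
  rw [hopfBarrier]
  linarith

variable [InnerProductSpace ℝ E]

theorem contDiff_hopfBarrier : ContDiff ℝ 2 (hopfBarrier β R z) :=
  (contDiff_const.mul ((contDiff_id.sub contDiff_const).norm_sq ℝ)).exp.sub contDiff_const

theorem hasDerivAt_exp_neg_mul (β s : ℝ) :
    HasDerivAt (fun s => Real.exp (-β * s)) (-β * Real.exp (-β * s)) s := by
  simpa [mul_comm] using ((hasDerivAt_id s).const_mul (-β)).exp

theorem fderiv_hopfBarrier_apply (hx₁ : dist x₁ z = R) :
    fderiv ℝ (hopfBarrier β R z) x₁ (z - x₁) = 2 * β * R ^ 2 * Real.exp (-β * R ^ 2) := by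
  have h : HasFDerivAt (hopfBarrier β R z) _ x₁ :=
    ((hasDerivAt_exp_neg_mul β _).comp_hasFDerivAt x₁ (hasFDerivAt_norm_sub_sq x₁ z)).sub_const _
  have hinner : ⟪x₁ - z, z - x₁⟫_ℝ = -R ^ 2 := by
    rw [← neg_sub x₁ z, inner_neg_right, real_inner_self_eq_norm_sq, ← dist_eq_norm, hx₁]
  rw [h.fderiv]
  simp only [smul_apply, smul_eq_mul, innerSL_apply_apply, hinner, ← dist_eq_norm, hx₁]
  ring

variable [FiniteDimensional ℝ E]

theorem laplacian_hopfBarrier (x : E) :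
    Δ (hopfBarrier β R z) x =
      (4 * β ^ 2 * ‖x - z‖ ^ 2 - 2 * Module.finrank ℝ E * β) * Real.exp (-β * ‖x - z‖ ^ 2) := by
  have h := laplacian_radial (φ := fun s => Real.exp (-β * s) - Real.exp (-β * R ^ 2))
    (φ' := fun s => -β * Real.exp (-β * s)) (x := x) (z := z)
    (Eventually.of_forall fun s => (hasDerivAt_exp_neg_mul β s).sub_const _)
    ((hasDerivAt_exp_neg_mul β _).const_mul (-β))
  exact h.trans (by ring)

theorem exists_hopfBarrier_subsolution (ha : 0 ≤ a) (hR : 0 < R) (z : E) :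
    ∃ β > 0, ∀ x, R / 2 ≤ dist x z →
      a * hopfBarrier β R z x ≤ Δ (hopfBarrier β R z) x := by
  obtain ⟨N, hN⟩ : ∃ N : ℝ, N = Module.finrank ℝ E := ⟨_, rfl⟩
  have hN0 : 0 ≤ N := hN ▸ Nat.cast_nonneg _
  have hβ : 0 < a + (2 * N + 1) / R ^ 2 := by positivity
  refine ⟨a + (2 * N + 1) / R ^ 2, hβ, fun x hx => ?_⟩
  set β := a + (2 * N + 1) / R ^ 2 with hβdef
  have hβR : β * R ^ 2 = a * R ^ 2 + (2 * N + 1) := by rw [hβdef]; field_simp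
  have hβa : a ≤ β := le_add_of_nonneg_right (by positivity)
  have hcoeff : a ≤ 4 * β ^ 2 * ‖x - z‖ ^ 2 - 2 * N * β := by
    rw [dist_eq_norm] at hx
    have hxR : R ^ 2 ≤ 4 * ‖x - z‖ ^ 2 := by nlinarith
    have : β ^ 2 * R ^ 2 ≤ β ^ 2 * (4 * ‖x - z‖ ^ 2) := by gcongr
    nlinarith [mul_nonneg hβ.le (mul_nonneg ha (sq_nonneg R))]
  rw [laplacian_hopfBarrier, ← hN]
  calc a * hopfBarrier β R z x ≤ a * Real.exp (-β * ‖x - z‖ ^ 2) := by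
        gcongr
        exact sub_le_self _ (Real.exp_pos _).le
    _ ≤ _ := by gcongr

variable [MeasurableSpace E] [BorelSpace E] [Nontrivial E] {D : Set E} {w : E → ℝ}

theorem frontier_annulus_subset {X : Type*} [PseudoMetricSpace X] (z : X) (r R : ℝ) :
    frontier ({x | r < dist x z} ∩ {x | dist x z < R}) ⊆ {x | dist x z = r ∨ dist x z = R} :=
  fun _ hy => (frontier_inter_subset _ _ hy).imp
    (fun h => (frontier_lt_subset_eq (g := fun x => dist x z) continuous_const
      (by fun_prop) h.1).symm)
    fun h => frontier_lt_subset_eq (f := fun x => dist x z) (by fun_prop) continuous_const h.2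

theorem mul_hopfBarrier_le_of_annulus {r ε : ℝ} (ha : 0 ≤ a) (hε : 0 ≤ ε) (hD : IsOpen D)
    (hball : closedBall z R ⊆ D) (hw : ContDiffOn ℝ 2 w D)
    (hlap : ∀ x ∈ ball z R, Δ w x ≤ a * w x)
    (hsub : ∀ x, r ≤ dist x z → a * hopfBarrier β R z x ≤ Δ (hopfBarrier β R z) x)
    (hbdry : ∀ x, dist x z = r ∨ dist x z = R → ε * hopfBarrier β R z x ≤ w x)
    {x : E} (hrx : r ≤ dist x z) (hxR : dist x z ≤ R) : ε * hopfBarrier β R z x ≤ w x := by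
  obtain hxb | hxb := em (dist x z = r ∨ dist x z = R)
  · exact hbdry x hxb
  push Not at hxb
  set U : Set E := {x | r < dist x z} ∩ {x | dist x z < R}
  have hU : IsOpen U :=
    (isOpen_lt continuous_const (by fun_prop)).inter (isOpen_lt (by fun_prop) continuous_const)
  have hUball : U ⊆ closedBall z R := fun y hy => ball_subset_closedBall (mem_ball.2 hy.2)
  have hv : ContDiff ℝ 2 (hopfBarrier β R z) := contDiff_hopfBarrier
  have hεv : ContDiff ℝ 2 (ε • hopfBarrier β R z) := hv.const_smul ε
  have hq : ContDiffOn ℝ 2 (w - ε • hopfBarrier β R z) D := hw.sub hεv.contDiffOn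
  refine sub_nonneg.1 (nonneg_of_laplacian_nonpos hU (isBounded_closedBall.subset hUball)
    (hq.mono (hUball.trans hball)) (fun y hy => ?_) (fun y hy hneg => ?_) x
    ⟨lt_of_le_of_ne hrx hxb.1.symm, lt_of_le_of_ne hxR hxb.2⟩)
  · have hyb := frontier_annulus_subset z r R hy
    have hyD : y ∈ D := hball (mem_closedBall.2 (by rcases hyb with h | h <;> linarith))
    have hcont := hq.continuousOn.continuousAt (hD.mem_nhds hyD)
    exact (LiminfNonneg.of_tendsto hcont (sub_nonneg.2 (hbdry y hyb))).mono nhdsWithin_le_nhds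
  · rw [(hw.contDiffAt (hD.mem_nhds (hball (hUball hy)))).laplacian_sub hεv.contDiffAt,
      InnerProductSpace.laplacian_smul ε hv.contDiffAt]
    calc Δ w y - ε • Δ (hopfBarrier β R z) y
        ≤ a * w y - ε • (a * hopfBarrier β R z y) :=
          sub_le_sub (hlap y hy.2) (mul_le_mul_of_nonneg_left (hsub y (le_of_lt hy.1)) hε)
      _ = a * (w - ε • hopfBarrier β R z) y := by
          simp only [Pi.sub_apply, Pi.smul_apply, smul_eq_mul]; ring
      _ ≤ 0 := mul_nonpos_of_nonneg_of_nonpos ha hneg.le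

theorem exists_mul_hopfBarrier_le (ha : 0 ≤ a) (hR : 0 < R) (hD : IsOpen D)
    (hball : closedBall z R ⊆ D) (hw : ContDiffOn ℝ 2 w D) (hpos : ∀ x ∈ ball z R, 0 < w x)
    (hlap : ∀ x ∈ ball z R, Δ w x ≤ a * w x) :
    ∃ β > 0, ∃ ε > 0, ∀ x, R / 2 ≤ dist x z → dist x z ≤ R → ε * hopfBarrier β R z x ≤ w x := by
  have hR2 : R / 2 < R := half_lt_self hR
  have hnonneg : ∀ x ∈ closedBall z R, 0 ≤ w x := by
    rw [← closure_ball z hR.ne'] at hball ⊢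
    exact fun x hx => le_on_closure (fun y hy => (hpos y hy).le) continuousOn_const
      (hw.continuousOn.mono hball) hx
  obtain ⟨β, hβ, hsub⟩ := exists_hopfBarrier_subsolution ha hR z
  obtain ⟨ε, hε, hεw⟩ : ∃ ε > 0, ∀ x ∈ sphere z (R / 2), ε ≤ w x :=
    (isCompact_sphere z (R / 2)).exists_forall_le' (hw.continuousOn.mono
      ((sphere_subset_ball hR2).trans (ball_subset_closedBall.trans hball)))
      fun x hx => hpos x (sphere_subset_ball hR2 hx)
  refine ⟨β, hβ, ε, hε, fun x => mul_hopfBarrier_le_of_annulus ha hε.le hD hball hw hlap hsub ?_⟩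
  rintro x (hx | hx)
  · exact (mul_le_of_le_one_right hε.le (hopfBarrier_le_one hβ.le x)).trans (hεw x hx)
  · rw [hopfBarrier_of_dist_eq hx, mul_zero]
    exact hnonneg x (mem_closedBall.2 hx.le)

theorem hopf_fderiv_pos (ha : 0 ≤ a) (hR : 0 < R) (hD : IsOpen D)
    (hball : closedBall z R ⊆ D) (hw : ContDiffOn ℝ 2 w D) (hpos : ∀ x ∈ ball z R, 0 < w x)
    (hlap : ∀ x ∈ ball z R, Δ w x ≤ a * w x) (hx₁ : dist x₁ z = R) (hwx₁ : w x₁ = 0) :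
    0 < fderiv ℝ w x₁ (z - x₁) := by
  obtain ⟨β, hβ, ε, hε, hle⟩ := exists_mul_hopfBarrier_le ha hR hD hball hw hpos hlap
  set q : E → ℝ := w - ε • hopfBarrier β R z with hq
  have hwd : DifferentiableAt ℝ w x₁ :=
    (hw.contDiffAt (hD.mem_nhds (hball hx₁.le))).differentiableAt (by norm_num)
  have hvd : DifferentiableAt ℝ (hopfBarrier β R z) x₁ :=
    contDiff_hopfBarrier.contDiffAt.differentiableAt (by norm_num)
  have hq₁ : q x₁ = 0 := by simp [hq, hwx₁, hopfBarrier_of_dist_eq hx₁]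
  set y : E := (1 / 2 : ℝ) • (z - x₁) with hy
  have hmin : IsMinOn q (segment ℝ x₁ (x₁ + y)) x₁ := by
    rintro x hx
    rw [segment_eq_image'] at hx
    obtain ⟨t, ⟨ht₀, ht₁⟩, rfl⟩ := hx
    have hdist : dist (x₁ + t • (x₁ + y - x₁)) z = (1 - t / 2) * R := by
      have : x₁ + t • (x₁ + y - x₁) - z = (1 - t / 2) • (x₁ - z) := by rw [hy]; module
      rw [dist_eq_norm, this, norm_smul, Real.norm_of_nonneg (by linarith),
        ← dist_eq_norm, hx₁]
    change q x₁ ≤ q _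
    rw [hq₁]
    exact sub_nonneg.2 (hle _ (by rw [hdist]; nlinarith) (by rw [hdist]; nlinarith))
  have hderiv : 0 ≤ fderiv ℝ q x₁ y := hmin.localize.hasFDerivWithinAt_nonneg
    (hwd.sub (hvd.const_smul ε)).hasFDerivAt.hasFDerivWithinAt
    (mem_posTangentConeAt_of_segment_subset subset_rfl)
  rw [hq, fderiv_sub hwd (hvd.const_smul ε), fderiv_const_smul hvd, hy] at hderiv
  simp only [map_smul, sub_apply, smul_apply, fderiv_hopfBarrier_apply hx₁, smul_eq_mul] at hderiv
  have : 0 < ε * (2 * β * R ^ 2 * Real.exp (-β * R ^ 2)) := by positivity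
  linarith

/-- The strong minimum principle: a ball on which `w` is positive cannot touch the zero set of `w`
from outside, by Hopf's lemma. -/
theorem eventually_eq_zero_of_laplacian_le (ha : 0 ≤ a) (hD : IsOpen D) (hw : ContDiffOn ℝ 2 w D)
    (hnonneg : ∀ x ∈ D, 0 ≤ w x) (hlap : ∀ x ∈ D, Δ w x ≤ a * w x) {x₀ : E} (hx₀ : x₀ ∈ D)
    (hwx₀ : w x₀ = 0) : ∀ᶠ x in 𝓝 x₀, w x = 0 := by
  obtain ⟨ρ, hρ, hball⟩ := nhds_basis_closedBall.mem_iff.1 (hD.mem_nhds hx₀)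
  filter_upwards [ball_mem_nhds x₀ (half_pos hρ)] with z hz
  by_contra hwz
  set Z : Set E := closedBall x₀ ρ ∩ w ⁻¹' {0}
  have hZ : IsCompact Z := (isCompact_closedBall x₀ ρ).of_isClosed_subset
    ((hw.continuousOn.mono hball).preimage_isClosed_of_isClosed isClosed_closedBall
      isClosed_singleton) inter_subset_left
  have hx₀Z : x₀ ∈ Z := ⟨mem_closedBall_self hρ.le, hwx₀⟩
  obtain ⟨x₁, ⟨hx₁ρ, hwx₁⟩, hmin⟩ := hZ.exists_isMinOn (f := fun x => dist x z) ⟨x₀, hx₀Z⟩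
    (by fun_prop)
  have hR : dist x₁ z < ρ / 2 := (hmin hx₀Z).trans_lt (mem_ball'.1 hz)
  have hsub : closedBall z (dist x₁ z) ⊆ closedBall x₀ ρ :=
    closedBall_subset_closedBall' (by linarith [mem_ball.1 hz])
  have hpos : ∀ x ∈ ball z (dist x₁ z), 0 < w x := fun x hx => by
    have hxρ := hsub (ball_subset_closedBall hx)
    exact (hnonneg x (hball hxρ)).lt_of_ne fun h =>
      (mem_ball.1 hx).not_ge (hmin ⟨hxρ, h.symm⟩)
  have hfderiv : fderiv ℝ w x₁ = 0 := IsLocalMin.fderiv_eq_zero <| by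
    filter_upwards [hD.mem_nhds (hball hx₁ρ)] with y hy
    exact (show w x₁ = 0 from hwx₁) ▸ hnonneg y hy
  have hx₁z : x₁ ≠ z := fun h => hwz (h ▸ hwx₁)
  have hHopf := hopf_fderiv_pos ha (dist_pos.2 hx₁z) hD (hsub.trans hball) hw
    hpos (fun x hx => hlap x (hball (hsub (ball_subset_closedBall hx)))) rfl hwx₁
  simp [hfderiv] at hHopf

end StrongMinimumPrinciple

section CooperativeChain

variable {E : Type*} [NormedAddCommGroup E] [InnerProductSpace ℝ E] [FiniteDimensional ℝ E]

/-- A chain `V 0, …, V m` of functions on `D` satisfying the cooperative differential inequalities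
`-ΔVᵢ + aᵢVᵢ ≥ Vᵢ₊₁`, closed up by `V m ≥ L (V 0)` wherever `V 0 < 0`. The functions are
nonnegative on the boundary of `D` except at the puncture `z`, where they are only bounded below. -/
structure IsCooperativeChain (m : ℕ) (a : ℕ → ℝ) (L : ℝ) (D : Set E) (z : E) (V : ℕ → E → ℝ) :
    Prop where
  isOpen : IsOpen D
  notMem : z ∉ D
  coeff_nonneg : ∀ i < m, 0 ≤ a i
  contDiffOn : ∀ i < m, ContDiffOn ℝ 2 (V i) D
  bddBelow : ∀ i < m, BddBelow (V i '' D)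
  liminfNonneg : ∀ i < m, ∀ y ∈ frontier D, y ≠ z → LiminfNonneg (V i) (𝓝[D] y)
  laplacian_le : ∀ i < m, ∀ x ∈ D, Δ (V i) x ≤ a i * V i x - V (i + 1) x
  min_le_last : ∀ x ∈ D, min 0 (L * V 0 x) ≤ V m x

namespace IsCooperativeChain

variable {m : ℕ} {a : ℕ → ℝ} {L : ℝ} {D A : Set E} {z : E} {V : ℕ → E → ℝ}

theorem last_nonneg (h : IsCooperativeChain m a L D z V) (hL : 0 ≤ L) {x : E} (hx : x ∈ D)
    (hV : 0 ≤ V 0 x) : 0 ≤ V m x := by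
  simpa [mul_nonneg hL hV] using h.min_le_last x hx

theorem exists_forall_neg_le (h : IsCooperativeChain m a L D z V) :
    ∃ B ≥ 0, ∀ i < m, ∀ x ∈ D, -B ≤ V i x := by
  have hbdd : BddBelow (⋃ i ∈ Finset.range m, V i '' D) :=
    (Finset.range m).finite_toSet.bddBelow_biUnion.2 fun i hi =>
      h.bddBelow i (Finset.mem_range.1 hi)
  obtain ⟨b, hb⟩ := hbdd
  refine ⟨|b|, abs_nonneg b, fun i hi x hx => (neg_abs_le b).trans (hb ?_)⟩
  exact mem_biUnion (Finset.mem_coe.2 (Finset.mem_range.2 hi)) (mem_image_of_mem _ hx)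

theorem eventually_eq_zero [MeasurableSpace E] [BorelSpace E] [Nontrivial E]
    (h : IsCooperativeChain m a L D z V) (hm : 1 ≤ m) (hL : 0 ≤ L)
    (hV : ∀ i < m, ∀ x ∈ D, 0 ≤ V i x) {x : E} (hx : x ∈ D) (hVx : V 0 x = 0) :
    ∀ᶠ y in 𝓝 x, V 0 y = 0 := by
  have hnext : ∀ y ∈ D, 0 ≤ V 1 y := fun y hy => by
    obtain rfl | hm := hm.eq_or_lt
    · exact h.last_nonneg hL hy (hV 0 zero_lt_one y hy)
    · exact hV 1 hm y hy
  exact eventually_eq_zero_of_laplacian_le (h.coeff_nonneg 0 hm) h.isOpen (h.contDiffOn 0 hm)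
    (hV 0 hm) (fun y hy => by linarith [h.laplacian_le 0 hm y hy, hnext y hy]) hx hVx

theorem eqOn_zero_of_isPreconnected [MeasurableSpace E] [BorelSpace E] [Nontrivial E]
    (h : IsCooperativeChain m a L D z V) (hm : 1 ≤ m) (hL : 0 ≤ L)
    (hV : ∀ i < m, ∀ x ∈ D, 0 ≤ V i x) {S : Set E} (hS : IsPreconnected S) (hSD : S ⊆ D) {x : E}
    (hx : x ∈ S) (hVx : V 0 x = 0) : EqOn (V 0) 0 S := by
  have hzero : ∀ y ∈ D, V 0 y = 0 → y ∈ interior {y | V 0 y = 0} := fun y hy hVy =>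
    mem_interior_iff_mem_nhds.2 (h.eventually_eq_zero hm hL hV hy hVy)
  refine (hS.subset_of_closure_inter_subset isOpen_interior ⟨x, hx, hzero x (hSD hx) hVx⟩ ?_).trans
    interior_subset
  rintro y ⟨hy, hyS⟩
  have hcont : ContinuousAt (V 0) y :=
    (h.contDiffOn 0 hm).continuousOn.continuousAt (h.isOpen.mem_nhds (hSD hyS))
  have hclosed := closure_mono interior_subset hy
  refine hzero y (hSD hyS) ?_
  simpa using hcont.continuousWithinAt.mem_closure hclosed (t := {0}) fun _ hw => hw

variable [MeasurableSpace E] [BorelSpace E] {B K θ R d : ℝ}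

theorem neg_mul_le (h : IsCooperativeChain m a L D z V) (hdim : 2 ≤ Module.finrank ℝ E)
    (hDb : Bornology.IsBounded D) (hd : diam D ≤ d) (hK : 0 ≤ K) (hθ : 0 ≤ θ)
    (hA : volume A ≤ volume (ball (0 : E) θ)) {i : ℕ} (hi : i < m)
    (hnext : ∀ x ∈ D, -A.indicator (fun _ => K) x ≤ V (i + 1) x) :
    ∀ x ∈ D, -(K * θ * d) ≤ V i x := by
  intro x hx
  refine le_trans (by gcongr) (abp_estimate_of_pole hdim h.isOpen h.notMem hDb (h.contDiffOn i hi)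
    (h.bddBelow i hi) (h.liminfNonneg i hi) hK hθ hA (fun y hy hneg => ?_) x hx)
  have hmul : a i * V i y ≤ 0 := mul_nonpos_of_nonneg_of_nonpos (h.coeff_nonneg i hi) hneg.le
  linarith [h.laplacian_le i hi y hy, hnext y hy]

theorem neg_mul_pow_le (h : IsCooperativeChain m a L D z V) (hdim : 2 ≤ Module.finrank ℝ E)
    (hDb : Bornology.IsBounded D) (hd : diam D ≤ d) (hK : 0 ≤ K) (hR : 0 ≤ R)
    (hDR : volume D ≤ volume (ball (0 : E) R)) (hlast : ∀ x ∈ D, -K ≤ V (m - 1) x) (k : ℕ) :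
    ∀ i, i + k + 1 = m → ∀ x ∈ D, -(K * (R * d) ^ k) ≤ V i x := by
  have hd₀ : 0 ≤ d := diam_nonneg.trans hd
  induction k with
  | zero =>
    rintro i rfl x hx
    simpa using hlast x hx
  | succ k ih =>
    intro i hi x hx
    have hnext := ih (i + 1) (by omega)
    have := h.neg_mul_le hdim hDb hd (K := K * (R * d) ^ k) (by positivity) hR hDR
      (i := i) (by omega) (fun y hy => by rw [indicator_of_mem hy]; exact hnext y hy) x hx
    rwa [show K * (R * d) ^ (k + 1) = K * (R * d) ^ k * R * d by ring]

/-- The negative parts shrink by the factor `L θ d (R d) ^ k`: the term `V m` only acts on `A`,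
where the domain is small. -/
theorem neg_half_le (h : IsCooperativeChain m a L D z V) (hdim : 2 ≤ Module.finrank ℝ E)
    (hDb : Bornology.IsBounded D) (hd : diam D ≤ d) (hL : 0 ≤ L) (hR : 0 ≤ R) (hθ : 0 ≤ θ)
    (hDR : volume D ≤ volume (ball (0 : E) R)) (hA : volume A ≤ volume (ball (0 : E) θ))
    (hVA : ∀ x ∈ D, x ∉ A → 0 ≤ V 0 x) (hsmall : ∀ k < m, L * θ * d * (R * d) ^ k ≤ 1 / 2)
    (hB : 0 ≤ B) (hV : ∀ i < m, ∀ x ∈ D, -B ≤ V i x) : ∀ i < m, ∀ x ∈ D, -(B / 2) ≤ V i x := by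
  intro i hi x hx
  have hm : 0 < m := by omega
  have htop : ∀ y ∈ D, -A.indicator (fun _ => L * B) y ≤ V (m - 1 + 1) y := fun y hy => by
    rw [Nat.sub_add_cancel hm]
    by_cases hyA : y ∈ A
    · rw [indicator_of_mem hyA]
      refine le_trans (le_min (by simpa using mul_nonneg hL hB) ?_) (h.min_le_last y hy)
      simpa using mul_le_mul_of_nonneg_left (hV 0 hm y hy) hL
    · rw [indicator_of_notMem hyA, neg_zero]
      exact h.last_nonneg hL hy (hVA y hy hyA)
  have hlast := h.neg_mul_le hdim hDb hd (mul_nonneg hL hB) hθ hA (by omega) htop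
  have hd₀ : 0 ≤ d := diam_nonneg.trans hd
  have hbound := h.neg_mul_pow_le hdim hDb hd (by positivity) hR hDR hlast (m - 1 - i) i (by omega)
    x hx
  nlinarith [hsmall (m - 1 - i) (by omega)]

end IsCooperativeChain

theorem nonneg_of_forall_neg_half_le {ι X : Type*} {p : ι → Prop} {D : Set X} {V : ι → X → ℝ}
    {B : ℝ} (hB : 0 ≤ B) (hV : ∀ i, p i → ∀ x ∈ D, -B ≤ V i x)
    (hhalf : ∀ B ≥ 0, (∀ i, p i → ∀ x ∈ D, -B ≤ V i x) → ∀ i, p i → ∀ x ∈ D, -(B / 2) ≤ V i x) :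
    ∀ i, p i → ∀ x ∈ D, 0 ≤ V i x := by
  have hpow (k : ℕ) : ∀ i, p i → ∀ x ∈ D, -(B * (1 / 2) ^ k) ≤ V i x := by
    induction k with
    | zero => simpa using hV
    | succ k ih => simpa [pow_succ, div_eq_mul_inv, mul_assoc] using hhalf _ (by positivity) ih
  intro i hi x hx
  have hlim : Tendsto (fun k : ℕ => -(B * (1 / 2 : ℝ) ^ k)) atTop (𝓝 0) := by
    simpa using ((tendsto_pow_atTop_nhds_zero_of_lt_one (r := (1 / 2 : ℝ)) (by norm_num)
      (by norm_num)).const_mul B).neg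
  exact le_of_tendsto' hlim fun k => hpow k i hi x hx

theorem exists_forall_isCooperativeChain_nonneg [MeasurableSpace E] [BorelSpace E]
    (hdim : 2 ≤ Module.finrank ℝ E) {Ω : Set E} (hΩ : Bornology.IsBounded Ω) (m : ℕ) {L : ℝ}
    (hL : 0 ≤ L) :
    ∃ η > 0, ∀ (a : ℕ → ℝ) (D A : Set E) (z : E) (V : ℕ → E → ℝ), D ⊆ Ω →
      IsCooperativeChain m a L D z V → volume A ≤ η → (∀ x ∈ D, x ∉ A → 0 ≤ V 0 x) →
      ∀ i < m, ∀ x ∈ D, 0 ≤ V i x := by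
  obtain ⟨R, hR, hΩR⟩ := hΩ.subset_ball_lt 0 0
  set C : ℝ := ∑ k ∈ Finset.range m, L * diam Ω * (R * diam Ω) ^ k
  have hterm (k : ℕ) : 0 ≤ L * diam Ω * (R * diam Ω) ^ k := by positivity
  obtain ⟨θ, hθ, hCθ⟩ : ∃ θ > 0, C * θ ≤ 1 / 2 :=
    have hC : 0 ≤ C := Finset.sum_nonneg fun k _ => hterm k
    ⟨1 / (2 * (C + 1)), by positivity, by field_simp; linarith⟩
  refine ⟨volume (ball (0 : E) θ), measure_ball_pos _ _ hθ, fun a D A z V hDΩ h hA hVA => ?_⟩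
  obtain ⟨B, hB, hV⟩ := h.exists_forall_neg_le
  have hsmall : ∀ k < m, L * θ * diam Ω * (R * diam Ω) ^ k ≤ 1 / 2 := fun k hk =>
    calc L * θ * diam Ω * (R * diam Ω) ^ k = L * diam Ω * (R * diam Ω) ^ k * θ := by ring
      _ ≤ C * θ := by
          gcongr
          exact Finset.single_le_sum (fun j _ => hterm j) (Finset.mem_range.2 hk)
      _ ≤ 1 / 2 := hCθ
  exact nonneg_of_forall_neg_half_le (p := (· < m)) hB hV fun B hB hV =>
    h.neg_half_le hdim (hΩ.subset hDΩ) (diam_mono hDΩ hΩ) hL hR.le hθ.le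
      (measure_mono (hDΩ.trans hΩR)) hA hVA hsmall hB hV

end CooperativeChain

section Reflection

variable {n : ℕ} [NeZero n]

/-- `reflectX1` as a linear isometry. -/
noncomputable def reflectX1Isometry : EuclideanSpace ℝ (Fin n) ≃ₗᵢ[ℝ] EuclideanSpace ℝ (Fin n) :=
  LinearIsometryEquiv.piLpCongrRight 2 fun j : Fin n =>
    if j = 0 then LinearIsometryEquiv.neg ℝ else LinearIsometryEquiv.refl ℝ ℝ

/-- Reflection across the hyperplane `{x₁ = c}`. -/
noncomputable def reflectAt (c : ℝ) (x : EuclideanSpace ℝ (Fin n)) : EuclideanSpace ℝ (Fin n) :=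
  reflectX1Isometry x + (2 * c) • EuclideanSpace.single 0 1

variable {c : ℝ} {x y : EuclideanSpace ℝ (Fin n)}

@[simp] theorem reflectAt_apply_zero (c : ℝ) (x : EuclideanSpace ℝ (Fin n)) :
    reflectAt c x 0 = 2 * c - x 0 := by
  simp [reflectAt, reflectX1Isometry]
  ring

theorem reflectAt_apply_of_ne (c : ℝ) (x : EuclideanSpace ℝ (Fin n)) {j : Fin n} (hj : j ≠ 0) :
    reflectAt c x j = x j := by
  simp [reflectAt, reflectX1Isometry, hj]

theorem eq_reflectAt_iff :
    y = reflectAt c x ↔ y 0 = 2 * c - x 0 ∧ ∀ j, j ≠ 0 → y j = x j := by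
  refine ⟨?_, fun h => ?_⟩
  · rintro rfl
    exact ⟨reflectAt_apply_zero c x, fun j hj => reflectAt_apply_of_ne c x hj⟩
  · ext j
    obtain rfl | hj := eq_or_ne j 0
    · rw [reflectAt_apply_zero, h.1]
    · rw [reflectAt_apply_of_ne c x hj, h.2 j hj]

theorem reflectX1_eq_reflectAt (x : EuclideanSpace ℝ (Fin n)) : reflectX1 x = reflectAt 0 x :=
  eq_reflectAt_iff.2 ⟨by simp [reflectX1], fun j hj => by simp [reflectX1, hj]⟩

@[simp] theorem reflectAt_reflectAt (c : ℝ) (x : EuclideanSpace ℝ (Fin n)) :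
    reflectAt c (reflectAt c x) = x :=
  (eq_reflectAt_iff.2 ⟨by simp, fun j hj => (reflectAt_apply_of_ne c x hj).symm⟩).symm

theorem reflectAt_eq_self (hx : x 0 = c) : reflectAt c x = x :=
  (eq_reflectAt_iff.2 ⟨by linarith, fun _ _ => rfl⟩).symm

theorem continuous_reflectAt_uncurry :
    Continuous fun p : ℝ × EuclideanSpace ℝ (Fin n) => reflectAt p.1 p.2 :=
  (reflectX1Isometry.continuous.comp continuous_snd).add (by fun_prop)

theorem contDiff_reflectAt (c : ℝ) {k : WithTop ℕ∞} :
    ContDiff ℝ k (reflectAt c : EuclideanSpace ℝ (Fin n) → _) :=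
  reflectX1Isometry.toContinuousLinearEquiv.contDiff.add contDiff_const

theorem continuous_reflectAt (c : ℝ) :
    Continuous (reflectAt c : EuclideanSpace ℝ (Fin n) → _) :=
  (contDiff_reflectAt c (k := 0)).continuous

theorem continuous_reflectAt_left (x : EuclideanSpace ℝ (Fin n)) :
    Continuous fun c => reflectAt c x :=
  continuous_reflectAt_uncurry.comp (Continuous.prodMk_left x)

theorem laplacian_comp_reflectAt (c : ℝ) (f : EuclideanSpace ℝ (Fin n) → ℝ)
    (x : EuclideanSpace ℝ (Fin n)) : Δ (fun y => f (reflectAt c y)) x = Δ f (reflectAt c x) :=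
  laplacian_comp_isometry_add f reflectX1Isometry _ x

/-- Steiner symmetry with respect to `{x₁ = 0}`: every line parallel to the `x₁`-axis meets `Ω` in
a segment (possibly empty or the whole line) centred on the hyperplane. -/
def IsSteinerSymmetric (Ω : Set (EuclideanSpace ℝ (Fin n))) : Prop :=
  ∀ x ∈ Ω, ∀ y, (∀ j, j ≠ 0 → y j = x j) → |y 0| ≤ |x 0| → y ∈ Ω

variable {Ω : Set (EuclideanSpace ℝ (Fin n))}

theorem IsSymmetricX1Domain.isSteinerSymmetric (hΩ : IsSymmetricX1Domain Ω) :
    IsSteinerSymmetric Ω := by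
  intro x hx y hyx hle
  have hr : reflectAt 0 x ∈ Ω := reflectX1_eq_reflectAt x ▸ hΩ.symmetric x hx
  obtain hx₀ | hx₀ := eq_or_ne (x 0) 0
  · have hyx₀ : y 0 = 2 * 0 - x 0 := by simpa [hx₀] using hle
    rwa [eq_reflectAt_iff.2 ⟨hyx₀, hyx⟩]
  obtain ⟨ht₁, ht₂⟩ : -1 ≤ y 0 / x 0 ∧ y 0 / x 0 ≤ 1 :=
    abs_le.1 (by rwa [abs_div, div_le_one (abs_pos.2 hx₀)])
  have hmem := hΩ.convexX1 x hx _ hr (fun j hj => (reflectAt_apply_of_ne 0 x hj).symm)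
    ((1 - y 0 / x 0) / 2) ⟨by linarith, by linarith⟩
  convert hmem using 1
  ext j
  obtain rfl | hj := eq_or_ne j 0
  · simp
    field_simp
    ring
  · simp [reflectAt_apply_of_ne, hj, hyx j hj]
    ring

theorem IsSteinerSymmetric.reflectAt_mem (hΩ : IsSteinerSymmetric Ω) (hc : 0 ≤ c) (hx : x ∈ Ω)
    (hcx : c ≤ x 0) : reflectAt c x ∈ Ω := by
  refine hΩ x hx _ (fun j hj => reflectAt_apply_of_ne c x hj) ?_
  rw [reflectAt_apply_zero, abs_of_nonneg (hc.trans hcx), abs_le]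
  constructor <;> linarith

theorem IsSteinerSymmetric.reflectAt_zero_mem_diff (hΩ : IsSteinerSymmetric Ω)
    (hx : x ∈ Ω \ {0}) : reflectAt 0 x ∈ Ω \ {0} := by
  refine ⟨hΩ x hx.1 _ (fun j hj => reflectAt_apply_of_ne 0 x hj) (by simp), fun h => hx.2 ?_⟩
  have h0 : reflectAt 0 x = 0 := h
  rw [mem_singleton_iff, ← reflectAt_reflectAt 0 x, h0, reflectAt_eq_self (by simp)]

theorem ne_zero_of_apply_zero_pos (hx : 0 < x 0) : x ≠ 0 := by
  rintro rfl
  simp at hx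

/-- The part of `Ω` to the right of `{x₁ = c}`, without the mirror image of the origin. -/
def puncturedCap (Ω : Set (EuclideanSpace ℝ (Fin n))) (c : ℝ) : Set (EuclideanSpace ℝ (Fin n)) :=
  Ω ∩ ({x | c < x 0} ∩ {x | reflectAt c x ≠ 0})

theorem isOpen_puncturedCap (hΩ : IsOpen Ω) : IsOpen (puncturedCap Ω c) :=
  hΩ.inter ((isOpen_lt continuous_const (by fun_prop)).inter
    (isOpen_ne_fun (continuous_reflectAt c) continuous_const))

theorem puncturedCap_subset (hc : 0 ≤ c) : puncturedCap Ω c ⊆ Ω \ {0} := fun _ hx =>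
  ⟨hx.1, ne_zero_of_apply_zero_pos (hc.trans_lt hx.2.1)⟩

theorem reflectAt_zero_notMem_puncturedCap : reflectAt c 0 ∉ puncturedCap Ω c := fun h =>
  h.2.2 (reflectAt_reflectAt c 0)

theorem IsSteinerSymmetric.reflectAt_mem_of_mem_puncturedCap (hΩ : IsSteinerSymmetric Ω)
    (hc : 0 ≤ c) (hx : x ∈ puncturedCap Ω c) : reflectAt c x ∈ Ω \ {0} :=
  ⟨hΩ.reflectAt_mem hc hx.1 (le_of_lt hx.2.1), hx.2.2⟩

theorem mem_frontier_puncturedCap (hΩ : IsOpen Ω) (hy : y ∈ frontier (puncturedCap Ω c))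
    (hne : y ≠ reflectAt c 0) : y ∈ frontier Ω ∨ (y ∈ Ω ∧ y 0 = c) := by
  rw [(isOpen_puncturedCap hΩ).frontier_eq] at hy
  have hcy : c ≤ y 0 := by
    have hcl : IsClosed {x : EuclideanSpace ℝ (Fin n) | c ≤ x 0} :=
      isClosed_le continuous_const (by fun_prop)
    exact closure_minimal (fun x hx => le_of_lt (show c < x 0 from hx.2.1)) hcl hy.1
  by_cases hyΩ : y ∈ Ω
  · refine Or.inr ⟨hyΩ, hcy.eq_or_lt.elim Eq.symm fun hlt => ?_⟩
    refine absurd ⟨hyΩ, hlt, fun h0 => hne ?_⟩ hy.2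
    rw [← h0, reflectAt_reflectAt]
  · exact Or.inl (hΩ.frontier_eq ▸ ⟨closure_mono inter_subset_left hy.1, hyΩ⟩)

theorem eventually_mem_puncturedCap (hx : x ∈ puncturedCap Ω c) :
    ∀ᶠ c' in 𝓝 c, x ∈ puncturedCap Ω c' := by
  filter_upwards [gt_mem_nhds (show c < x 0 from hx.2.1),
    (continuous_reflectAt_left x).continuousAt.eventually_ne hx.2.2] with c' h₁ h₂
  exact ⟨hx.1, h₁, h₂⟩

/-- The part to the right of `{x₁ = c}` of the section of `Ω` by the line through `p` parallel to
the `x₁`-axis. -/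
def rightChord (Ω : Set (EuclideanSpace ℝ (Fin n))) (c : ℝ) (p : EuclideanSpace ℝ (Fin n)) :
    Set (EuclideanSpace ℝ (Fin n)) :=
  {x ∈ Ω | c < x 0 ∧ ∀ j, j ≠ 0 → x j = p j}

variable {p : EuclideanSpace ℝ (Fin n)}

theorem IsSteinerSymmetric.convex_rightChord (hΩ : IsSteinerSymmetric Ω) (hc : 0 ≤ c) :
    Convex ℝ (rightChord Ω c p) := by
  rintro x ⟨hxΩ, hcx, hxp⟩ y ⟨hyΩ, hcy, hyp⟩ s t hs ht hst
  have hcoord (j : Fin n) : (s • x + t • y) j = s * x j + t * y j := by simp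
  have hoff : ∀ j, j ≠ 0 → (s • x + t • y) j = p j := fun j hj => by
    rw [hcoord, hxp j hj, hyp j hj, ← add_mul, hst, one_mul]
  have hlow : c < (s • x + t • y) 0 := by
    rw [hcoord]
    exact convex_Ioi c hcx hcy hs ht hst
  refine ⟨?_, hlow, hoff⟩
  obtain ⟨z, hzΩ, hzp, hle⟩ :
      ∃ z ∈ Ω, (∀ j, j ≠ 0 → z j = p j) ∧ (s • x + t • y) 0 ≤ z 0 := by
    have hmax : (s • x + t • y) 0 ≤ max (x 0) (y 0) := by
      rw [hcoord]
      exact convex_Iic (max (x 0) (y 0)) (mem_Iic.2 (le_max_left _ _))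
        (mem_Iic.2 (le_max_right _ _)) hs ht hst
    obtain hz | hz := le_max_iff.1 hmax
    · exact ⟨x, hxΩ, hxp, hz⟩
    · exact ⟨y, hyΩ, hyp, hz⟩
  refine hΩ z hzΩ _ (fun j hj => (hoff j hj).trans (hzp j hj).symm) ?_
  rw [abs_of_pos (hc.trans_lt hlow)]
  exact hle.trans (le_abs_self _)

theorem closure_rightChord_subset :
    closure (rightChord Ω c p) ⊆ {x | ∀ j, j ≠ 0 → x j = p j} := by
  refine closure_minimal (fun x hx => hx.2.2) ?_
  simp only [ofPred_forall]
  exact isClosed_iInter fun j => isClosed_iInter fun _ =>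
    isClosed_eq (by fun_prop) continuous_const

theorem exists_mem_frontier_closure_rightChord (hΩ : IsOpen Ω) (hΩb : Bornology.IsBounded Ω)
    (hp : p ∈ Ω) (hcp : c < p 0) : ∃ y ∈ closure (rightChord Ω c p), y ∈ frontier Ω ∧ c < y 0 := by
  have hsub : rightChord Ω c p ⊆ Ω := sep_subset _ _
  have hpS : p ∈ rightChord Ω c p := ⟨hp, hcp, fun _ _ => rfl⟩
  obtain ⟨y, hy, hmax⟩ := (hΩb.subset hsub).isCompact_closure.exists_isMaxOn
    ⟨p, subset_closure hpS⟩ (f := fun x => x 0) (by fun_prop)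
  have hcy : c < y 0 := hcp.trans_le (hmax (subset_closure hpS))
  refine ⟨y, hy, hΩ.frontier_eq ▸ ⟨closure_mono hsub hy, fun hyΩ => ?_⟩, hcy⟩
  have hcont : Continuous fun t : ℝ => y + t • EuclideanSpace.single (0 : Fin n) (1 : ℝ) := by
    fun_prop
  have hnear : ∀ᶠ t in 𝓝[>] (0 : ℝ), y + t • EuclideanSpace.single (0 : Fin n) (1 : ℝ) ∈ Ω :=
    nhdsWithin_le_nhds (hcont.continuousAt.eventually (by simpa using hΩ.mem_nhds hyΩ))
  obtain ⟨t, htΩ, ht⟩ := (hnear.and self_mem_nhdsWithin).exists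
  have hle : y 0 + t ≤ y 0 := by
    simpa using hmax (subset_closure ⟨htΩ, hcy.trans_le (by simpa using le_of_lt ht), fun j hj => by
      simpa [hj] using closure_rightChord_subset hy j hj⟩)
  exact hle.not_gt (lt_add_of_pos_right _ ht)

theorem IsSteinerSymmetric.reflectAt_mem_of_mem_closure_rightChord (hΩ : IsSteinerSymmetric Ω)
    (hc : 0 < c) (hy : y ∈ closure (rightChord Ω c p)) (hcy : c < y 0) : reflectAt c y ∈ Ω := by
  have hlt : |2 * c - y 0| < y 0 := abs_lt.2 ⟨by linarith, by linarith⟩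
  have hcont : Continuous fun x : EuclideanSpace ℝ (Fin n) => x 0 := by fun_prop
  obtain ⟨x, ⟨hxΩ, -, hxp⟩, hx⟩ := ((mem_closure_iff_frequently.1 hy).and_eventually
    (hcont.continuousAt.eventually (lt_mem_nhds hlt))).exists
  refine hΩ x hxΩ _ (fun j hj => ?_) ?_
  · rw [reflectAt_apply_of_ne c y hj, closure_rightChord_subset hy j hj, hxp j hj]
  · rw [reflectAt_apply_zero]
    exact hx.le.trans (le_abs_self _)

/-- The increment of `u` under reflection across `{x₁ = c}`. -/
noncomputable def reflectDiff (c : ℝ) (u : EuclideanSpace ℝ (Fin n) → ℝ)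
    (x : EuclideanSpace ℝ (Fin n)) : ℝ :=
  u (reflectAt c x) - u x

end Reflection

section System

variable {n : ℕ} [NeZero n]

/-- A chain `-ΔUᵢ + aᵢUᵢ = Uᵢ₊₁` (`i < m`) closed up by `U m = f (U 0)` on `Ω \ {0}`, with zero
boundary values, components bounded below, and positive first component. The equation
`∏ᵢ (-Δ + aᵢ) u = f u` takes this form with `Uᵢ = ∏_{j < i} (-Δ + aⱼ) u`. -/
structure IsCooperativeSystem (m : ℕ) (a : ℕ → ℝ) (f : ℝ → ℝ) (Ω : Set (EuclideanSpace ℝ (Fin n)))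
    (U : ℕ → EuclideanSpace ℝ (Fin n) → ℝ) : Prop where
  isOpen : IsOpen Ω
  isBounded : Bornology.IsBounded Ω
  isSteinerSymmetric : IsSteinerSymmetric Ω
  locallyLipschitzOn : LocallyLipschitzOn (Ici 0) f
  map_zero_nonneg : 0 ≤ f 0
  monotoneOn : MonotoneOn f (Ici 0)
  coeff_nonneg : ∀ i < m, 0 ≤ a i
  contDiffOn : ∀ i < m, ContDiffOn ℝ 2 (U i) (Ω \ {0})
  laplacian_eq : ∀ i < m, ∀ x ∈ Ω \ {0}, Δ (U i) x = a i * U i x - U (i + 1) x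
  last_eq : ∀ x ∈ Ω \ {0}, U m x = f (U 0 x)
  pos : ∀ x ∈ Ω \ {0}, 0 < U 0 x
  tendsto_frontier : ∀ i < m, ∀ y ∈ frontier Ω, Tendsto (U i) (𝓝[Ω \ {0}] y) (𝓝 0)
  bddBelow : ∀ i < m, BddBelow (U i '' (Ω \ {0}))

namespace IsCooperativeSystem

variable {m : ℕ} {a : ℕ → ℝ} {f : ℝ → ℝ} {Ω : Set (EuclideanSpace ℝ (Fin n))}
  {U : ℕ → EuclideanSpace ℝ (Fin n) → ℝ} {c : ℝ} {x : EuclideanSpace ℝ (Fin n)} {i : ℕ}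

theorem isOpen_diff (h : IsCooperativeSystem m a f Ω U) : IsOpen (Ω \ {0}) :=
  h.isOpen.sdiff isClosed_singleton

theorem continuousAt (h : IsCooperativeSystem m a f Ω U) (hi : i < m) (hx : x ∈ Ω \ {0}) :
    ContinuousAt (U i) x :=
  (h.contDiffOn i hi).continuousOn.continuousAt (h.isOpen_diff.mem_nhds hx)

theorem last_nonneg (h : IsCooperativeSystem m a f Ω U) (hx : x ∈ Ω \ {0}) : 0 ≤ U m x := by
  have hpos := (h.pos x hx).le
  rw [h.last_eq x hx]
  exact h.map_zero_nonneg.trans (h.monotoneOn self_mem_Ici hpos hpos)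

theorem isCooperativeChain (h : IsCooperativeSystem m a f Ω U) :
    IsCooperativeChain m a 0 (Ω \ {0}) 0 U where
  isOpen := h.isOpen_diff
  notMem := fun h0 => h0.2 rfl
  coeff_nonneg := h.coeff_nonneg
  contDiffOn := h.contDiffOn
  bddBelow := h.bddBelow
  liminfNonneg := fun i hi y hy hy0 => by
    rw [h.isOpen_diff.frontier_eq] at hy
    have hyΩ : y ∈ frontier Ω := h.isOpen.frontier_eq ▸
      ⟨closure_mono sdiff_subset hy.1, fun hyΩ => hy.2 ⟨hyΩ, hy0⟩⟩
    exact .of_tendsto (h.tendsto_frontier i hi y hyΩ) le_rfl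
  laplacian_le := fun i hi x hx => (h.laplacian_eq i hi x hx).le
  min_le_last := fun x hx => (min_le_left _ _).trans (h.last_nonneg hx)

theorem nonneg (h : IsCooperativeSystem m a f Ω U) (hn : 2 ≤ n) (hi : i < m) (hx : x ∈ Ω \ {0}) :
    0 ≤ U i x := by
  obtain ⟨η, -, hη⟩ := exists_forall_isCooperativeChain_nonneg
    (E := EuclideanSpace ℝ (Fin n)) (by simpa) h.isBounded m le_rfl
  exact hη a _ ∅ 0 U sdiff_subset h.isCooperativeChain (by simp) (fun x hx _ => (h.pos x hx).le)
    i hi x hx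

theorem exists_forall_le (h : IsCooperativeSystem m a f Ω U) (hi : i < m) (hc : 0 < c) :
    ∃ B, ∀ x ∈ Ω, c ≤ x 0 → U i x ≤ B := by
  set K : Set (EuclideanSpace ℝ (Fin n)) := closure Ω ∩ {x | c ≤ x 0}
  have hK : IsCompact K := h.isBounded.isCompact_closure.inter_right
    (isClosed_le continuous_const (by fun_prop))
  have hne : ∀ y : EuclideanSpace ℝ (Fin n), c ≤ y 0 → y ≠ 0 := fun y hy =>
    ne_zero_of_apply_zero_pos (hc.trans_le hy)
  have hcl : K ⊆ closure (Ω \ {0}) := fun y hy => by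
    rw [sdiff_eq, inter_comm]
    exact isOpen_compl_singleton.inter_closure ⟨hne y hy.2, hy.1⟩
  have hlim : ∀ y ∈ K, ∃ b, Tendsto (U i) (𝓝[Ω \ {0}] y) (𝓝 b) := fun y hy => by
    by_cases hyΩ : y ∈ Ω
    · exact ⟨U i y, (h.contDiffOn i hi).continuousOn y ⟨hyΩ, hne y hy.2⟩⟩
    · exact ⟨0, h.tendsto_frontier i hi y (h.isOpen.frontier_eq ▸ ⟨hy.1, hyΩ⟩)⟩
  obtain ⟨B, hB⟩ := hK.bddAbove_image (continuousOn_extendFrom hcl hlim)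
  refine ⟨B, fun x hx hcx => ?_⟩
  have hmem : x ∈ Ω \ {0} := ⟨hx, hne x hcx⟩
  rw [← extendFrom_extends (h.contDiffOn i hi).continuousOn x hmem]
  exact hB (mem_image_of_mem _ ⟨subset_closure hx, hcx⟩)

theorem contDiffOn_reflectDiff (h : IsCooperativeSystem m a f Ω U) (hi : i < m) (hc : 0 ≤ c) :
    ContDiffOn ℝ 2 (reflectDiff c (U i)) (puncturedCap Ω c) :=
  ((h.contDiffOn i hi).comp (contDiff_reflectAt c).contDiffOn fun _ hx =>
    h.isSteinerSymmetric.reflectAt_mem_of_mem_puncturedCap hc hx).sub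
    ((h.contDiffOn i hi).mono (puncturedCap_subset hc))

theorem laplacian_reflectDiff (h : IsCooperativeSystem m a f Ω U) (hi : i < m) (hc : 0 ≤ c)
    (hx : x ∈ puncturedCap Ω c) : Δ (reflectDiff c (U i)) x =
      a i * reflectDiff c (U i) x - reflectDiff c (U (i + 1)) x := by
  have hr := h.isSteinerSymmetric.reflectAt_mem_of_mem_puncturedCap hc hx
  have hx' := puncturedCap_subset hc hx
  have hU {y} (hy : y ∈ Ω \ {0}) : ContDiffAt ℝ 2 (U i) y :=
    (h.contDiffOn i hi).contDiffAt (h.isOpen_diff.mem_nhds hy)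
  have hsub : Δ (reflectDiff c (U i)) x = Δ (fun y => U i (reflectAt c y)) x - Δ (U i) x :=
    ((hU hr).comp x (contDiff_reflectAt c).contDiffAt).laplacian_sub (hU hx')
  rw [hsub, laplacian_comp_reflectAt, h.laplacian_eq i hi _ hr, h.laplacian_eq i hi _ hx']
  simp only [reflectDiff]
  ring

theorem bddBelow_reflectDiff (h : IsCooperativeSystem m a f Ω U) (hi : i < m) (hc : 0 < c) :
    BddBelow (reflectDiff c (U i) '' puncturedCap Ω c) := by
  obtain ⟨b, hb⟩ := h.bddBelow i hi
  obtain ⟨B, hB⟩ := h.exists_forall_le hi hc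
  refine ⟨b - B, forall_mem_image.2 fun x hx => sub_le_sub ?_ (hB x hx.1 (le_of_lt hx.2.1))⟩
  exact hb (mem_image_of_mem _ (h.isSteinerSymmetric.reflectAt_mem_of_mem_puncturedCap hc.le hx))

theorem liminfNonneg_reflectDiff (h : IsCooperativeSystem m a f Ω U) (hn : 2 ≤ n) (hi : i < m)
    (hc : 0 < c) {y : EuclideanSpace ℝ (Fin n)} (hy : y ∈ frontier (puncturedCap Ω c))
    (hne : y ≠ reflectAt c 0) : LiminfNonneg (reflectDiff c (U i)) (𝓝[puncturedCap Ω c] y) := by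
  obtain hyΩ | ⟨hyΩ, hyc⟩ := mem_frontier_puncturedCap h.isOpen hy hne
  · have hneg : LiminfNonneg (fun x => -U i x) (𝓝[puncturedCap Ω c] y) := by
      have hlim := (h.tendsto_frontier i hi y hyΩ).neg
      rw [neg_zero] at hlim
      exact (LiminfNonneg.of_tendsto hlim le_rfl).mono
        (nhdsWithin_mono y (puncturedCap_subset hc.le))
    intro ε hε
    filter_upwards [hneg ε hε, self_mem_nhdsWithin] with x hx hxD
    have hr := h.nonneg hn hi (h.isSteinerSymmetric.reflectAt_mem_of_mem_puncturedCap hc.le hxD)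
    exact hx.trans_le (by simpa [reflectDiff] using hr)
  · have hyr := reflectAt_eq_self hyc
    have hUy := h.continuousAt hi ⟨hyΩ, ne_zero_of_apply_zero_pos (hyc ▸ hc)⟩
    have hcont : ContinuousAt (reflectDiff c (U i)) y :=
      (ContinuousAt.comp (by rwa [hyr]) (continuous_reflectAt c).continuousAt).sub hUy
    exact .of_tendsto (hcont.tendsto.mono_left nhdsWithin_le_nhds) (by simp [reflectDiff, hyr])

theorem min_le_reflectDiff_last (h : IsCooperativeSystem m a f Ω U) (hc : 0 ≤ c)
    {L : NNReal} {B : ℝ} (hf : LipschitzOnWith L f (Icc 0 B)) (hx : x ∈ puncturedCap Ω c)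
    (hB : U 0 x ≤ B) : min 0 (L * reflectDiff c (U 0) x) ≤ reflectDiff c (U m) x := by
  have hr := h.isSteinerSymmetric.reflectAt_mem_of_mem_puncturedCap hc hx
  have hx' := puncturedCap_subset hc hx
  have hposr := (h.pos _ hr).le
  have hposx := (h.pos _ hx').le
  simp only [reflectDiff, h.last_eq _ hr, h.last_eq _ hx']
  obtain hle | hlt := le_or_gt (U 0 x) (U 0 (reflectAt c x))
  · exact (min_le_left _ _).trans (sub_nonneg.2 (h.monotoneOn hposx hposr hle))
  · refine (min_le_right _ _).trans ?_
    have hdist := hf.dist_le_mul _ ⟨hposr, hlt.le.trans hB⟩ _ ⟨hposx, hB⟩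
    rw [Real.dist_eq, Real.dist_eq, abs_of_neg (sub_neg.2 hlt), mul_neg] at hdist
    simpa using (abs_le.1 hdist).1

theorem exists_forall_isCooperativeChain_reflectDiff (h : IsCooperativeSystem m a f Ω U)
    (hn : 2 ≤ n) (hm : 1 ≤ m) {c₀ : ℝ} (hc₀ : 0 < c₀) :
    ∃ L ≥ 0, ∀ c ≥ c₀, IsCooperativeChain m a L (puncturedCap Ω c) (reflectAt c 0)
      fun i => reflectDiff c (U i) := by
  obtain ⟨B, hB⟩ := h.exists_forall_le hm hc₀
  obtain ⟨L, hL⟩ := (h.locallyLipschitzOn.mono Icc_subset_Ici_self)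
    |>.exists_lipschitzOnWith_of_compact isCompact_Icc
  refine ⟨L, L.2, fun c hc => ?_⟩
  have hc₀' : 0 < c := hc₀.trans_le hc
  exact {
    isOpen := isOpen_puncturedCap h.isOpen
    notMem := reflectAt_zero_notMem_puncturedCap
    coeff_nonneg := h.coeff_nonneg
    contDiffOn := fun i hi => h.contDiffOn_reflectDiff hi hc₀'.le
    bddBelow := fun i hi => h.bddBelow_reflectDiff hi hc₀'
    liminfNonneg := fun i hi y hy hne => h.liminfNonneg_reflectDiff hn hi hc₀' hy hne
    laplacian_le := fun i hi x hx => (h.laplacian_reflectDiff hi hc₀'.le hx).le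
    min_le_last := fun x hx => h.min_le_reflectDiff_last hc₀'.le hL hx
      (hB x hx.1 (hc.trans (le_of_lt hx.2.1))) }

end IsCooperativeSystem

end System

theorem forall_gt_of_continuation {P : ℝ → Prop} {a : ℝ} (hlarge : ∀ᶠ c in atTop, P c)
    (hclosed : ∀ μ > a, (∀ c > μ, P c) → P μ) (hopen : ∀ μ > a, P μ → ∀ᶠ c in 𝓝[<] μ, P c) :
    ∀ c > a, P c := by
  by_contra! hex
  obtain ⟨c, hac, hc⟩ := hex
  obtain ⟨b, hb⟩ := eventually_atTop.1 hlarge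
  have hbdd : BddAbove {c | ¬P c} := ⟨b, fun c hc => le_of_not_ge fun hbc => hc (hb c hbc)⟩
  set μ := sSup {c | ¬P c}
  have hμ : a < μ := hac.trans_le (le_csSup hbdd hc)
  have hPμ : P μ := hclosed μ hμ fun c hc => not_not.1 fun hPc => hc.not_ge (le_csSup hbdd hPc)
  obtain ⟨l, hl, hlP⟩ := mem_nhdsLT_iff_exists_Ioo_subset.1 (hopen μ hμ hPμ)
  obtain ⟨c', hPc', hlc'⟩ := exists_lt_of_lt_csSup ⟨c, hc⟩ hl
  obtain hlt | heq := (le_csSup hbdd hPc').lt_or_eq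
  · exact hPc' (hlP ⟨hlc', hlt⟩)
  · exact hPc' (heq ▸ hPμ)

theorem ae_apply_ne {ι : Type*} [Fintype ι] (j : ι) (μ : ℝ) :
    ∀ᵐ x : EuclideanSpace ℝ ι, x j ≠ μ :=
  (PiLp.volume_preserving_ofLp ι).quasiMeasurePreserving.ae
    (Measure.ae_eval_ne (fun _ : ι => volume) j μ)

section MovingPlanes

variable {n : ℕ} [NeZero n]

/-- The inequality that the method of moving planes propagates from large `c` down to `c = 0`. -/
def ReflectDiffNonneg (m : ℕ) (Ω : Set (EuclideanSpace ℝ (Fin n)))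
    (U : ℕ → EuclideanSpace ℝ (Fin n) → ℝ) (c : ℝ) : Prop :=
  ∀ i < m, ∀ x ∈ puncturedCap Ω c, 0 ≤ reflectDiff c (U i) x

/-- The set where the reflected difference across `{x₁ = c}` is negative. Membership of the
reflected point is part of the definition, so that the set is open for every `c`. -/
def badSet (Ω : Set (EuclideanSpace ℝ (Fin n))) (u : EuclideanSpace ℝ (Fin n) → ℝ) (c : ℝ) :
    Set (EuclideanSpace ℝ (Fin n)) :=
  ((Ω \ {0}) ∩ ({x | c < x 0} ∩ reflectAt c ⁻¹' (Ω \ {0}))) ∩ reflectDiff c u ⁻¹' Iio 0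

namespace IsCooperativeSystem

variable {m : ℕ} {a : ℕ → ℝ} {f : ℝ → ℝ} {Ω : Set (EuclideanSpace ℝ (Fin n))}
  {U : ℕ → EuclideanSpace ℝ (Fin n) → ℝ} {c μ : ℝ} {x y : EuclideanSpace ℝ (Fin n)}

theorem eventually_reflectDiff_pos (h : IsCooperativeSystem m a f Ω U) (hm : 1 ≤ m)
    (hy : y ∈ frontier Ω) (hr : reflectAt c y ∈ Ω \ {0}) :
    ∀ᶠ x in 𝓝[Ω \ {0}] y, 0 < reflectDiff c (U 0) x := by
  have hrefl : Tendsto (fun x => U 0 (reflectAt c x)) (𝓝[Ω \ {0}] y) (𝓝 (U 0 (reflectAt c y))) :=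
    ((h.continuousAt hm hr).tendsto.comp (continuous_reflectAt c).continuousAt.tendsto).mono_left
      nhdsWithin_le_nhds
  have hlim := hrefl.sub (h.tendsto_frontier 0 hm y hy)
  rw [sub_zero] at hlim
  exact hlim.eventually (lt_mem_nhds (h.pos _ hr))

theorem reflectDiff_ne_zero_of_apply_ne_zero (h : IsCooperativeSystem m a f Ω U) (hn : 2 ≤ n)
    (hm : 1 ≤ m) (hc : 0 < c) (hnonneg : ReflectDiffNonneg m Ω U c) (hx : x ∈ puncturedCap Ω c)
    {j : Fin n} (hj : j ≠ 0) (hxj : x j ≠ 0) : reflectDiff c (U 0) x ≠ 0 := by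
  intro hzero
  obtain ⟨L, hL, hchain⟩ := h.exists_forall_isCooperativeChain_reflectDiff hn hm hc
  have hoff : ∀ y, y j = x j → reflectAt c y ≠ 0 := fun y hyx h0 => hxj <| by
    rw [← hyx, ← reflectAt_apply_of_ne c y hj, h0, PiLp.zero_apply]
  have hsub : rightChord Ω c x ⊆ puncturedCap Ω c := fun y hy =>
    ⟨hy.1, hy.2.1, hoff y (hy.2.2 j hj)⟩
  have heq : EqOn (reflectDiff c (U 0)) 0 (rightChord Ω c x) :=
    (hchain c le_rfl).eqOn_zero_of_isPreconnected hm hL hnonneg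
      (h.isSteinerSymmetric.convex_rightChord hc.le).isPreconnected hsub
      ⟨hx.1, hx.2.1, fun _ _ => rfl⟩ hzero
  obtain ⟨y, hy, hyΩ, hcy⟩ :=
    exists_mem_frontier_closure_rightChord h.isOpen h.isBounded hx.1 hx.2.1
  have hr : reflectAt c y ∈ Ω \ {0} :=
    ⟨h.isSteinerSymmetric.reflectAt_mem_of_mem_closure_rightChord hc hy hcy,
      hoff y (closure_rightChord_subset hy j hj)⟩
  have : (𝓝[rightChord Ω c x] y).NeBot := mem_closure_iff_nhdsWithin_neBot.1 hy
  have hpos := (h.eventually_reflectDiff_pos hm hyΩ hr).filter_mono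
    (nhdsWithin_mono y (hsub.trans (puncturedCap_subset hc.le)))
  obtain ⟨z, hz, hzpos⟩ := (eventually_mem_nhdsWithin.and hpos).exists
  exact hzpos.ne' (heq hz)

theorem reflectDiff_pos (h : IsCooperativeSystem m a f Ω U) (hn : 2 ≤ n) (hm : 1 ≤ m)
    (hc : 0 < c) (hnonneg : ReflectDiffNonneg m Ω U c) (hx : x ∈ puncturedCap Ω c) :
    0 < reflectDiff c (U 0) x := by
  refine (hnonneg 0 hm x hx).lt_of_ne' fun hzero => ?_
  obtain ⟨L, hL, hchain⟩ := h.exists_forall_isCooperativeChain_reflectDiff hn hm hc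
  have : Nontrivial (Fin n) := Fin.nontrivial_iff_two_le.2 hn
  obtain ⟨j, hj⟩ := exists_ne (0 : Fin n)
  -- The reflected origin may separate the chord of a point on the `x₁`-axis, so move off the axis.
  have hdense : Dense {y : EuclideanSpace ℝ (Fin n) | y j ≠ 0} :=
    Measure.dense_of_ae (ae_apply_ne j 0)
  have hnear : ∀ᶠ y in 𝓝 x, y ∈ puncturedCap Ω c ∧ reflectDiff c (U 0) y = 0 :=
    ((isOpen_puncturedCap h.isOpen).eventually_mem hx).and
      ((hchain c le_rfl).eventually_eq_zero hm hL hnonneg hx hzero)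
  obtain ⟨y, hyj, hy, hyzero⟩ :=
    ((mem_closure_iff_frequently.1 (hdense x)).and_eventually hnear).exists
  exact h.reflectDiff_ne_zero_of_apply_ne_zero hn hm hc hnonneg hy hj hyj hyzero

theorem tendsto_reflectDiff (h : IsCooperativeSystem m a f Ω U) {i : ℕ} (hi : i < m)
    (hx : reflectAt μ x ∈ Ω \ {0}) :
    Tendsto (fun c => reflectDiff c (U i) x) (𝓝 μ) (𝓝 (reflectDiff μ (U i) x)) :=
  ((h.continuousAt hi hx).tendsto.comp
    (continuous_reflectAt_left x).continuousAt.tendsto).sub_const _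

theorem reflectDiffNonneg_of_forall_gt (h : IsCooperativeSystem m a f Ω U) (hμ : 0 ≤ μ)
    (hgt : ∀ c > μ, ReflectDiffNonneg m Ω U c) : ReflectDiffNonneg m Ω U μ := by
  intro i hi x hx
  have hlim := (h.tendsto_reflectDiff hi
    (h.isSteinerSymmetric.reflectAt_mem_of_mem_puncturedCap hμ hx)).mono_left
    (nhdsWithin_le_nhds (s := Ioi μ))
  refine ge_of_tendsto hlim ?_
  filter_upwards [nhdsWithin_le_nhds (eventually_mem_puncturedCap hx), self_mem_nhdsWithin]
    with c hxc hc using hgt c hc i hi x hxc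

theorem isOpen_badSet (h : IsCooperativeSystem m a f Ω U) (hm : 1 ≤ m) :
    IsOpen (badSet Ω (U 0) c) := by
  refine ContinuousOn.isOpen_inter_preimage (fun x hx => ContinuousAt.continuousWithinAt ?_)
    (h.isOpen_diff.inter ((isOpen_lt continuous_const (by fun_prop)).inter
      (h.isOpen_diff.preimage (continuous_reflectAt c)))) isOpen_Iio
  exact ((h.continuousAt hm hx.2.2).comp (continuous_reflectAt c).continuousAt).sub
    (h.continuousAt hm hx.1)

theorem tendsto_volume_badSet (h : IsCooperativeSystem m a f Ω U) (hm : 1 ≤ m) (hμ : 0 ≤ μ)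
    (hpos : ∀ x ∈ puncturedCap Ω μ, 0 < reflectDiff μ (U 0) x) :
    Tendsto (fun c => volume (badSet Ω (U 0) c)) (𝓝[<] μ) (𝓝 0) := by
  rw [← measure_empty (μ := (volume : Measure (EuclideanSpace ℝ (Fin n))))]
  refine tendsto_measure_of_ae_tendsto_indicator _ MeasurableSet.empty
    (fun c => (h.isOpen_badSet hm).measurableSet) h.isOpen.measurableSet
    h.isBounded.measure_lt_top.ne (Eventually.of_forall fun c x hx => hx.1.1.1) ?_
  filter_upwards [ae_apply_ne 0 μ, Measure.ae_ne volume (reflectAt μ 0)] with x hxμ hxr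
  simp only [mem_empty_iff_false, iff_false]
  obtain hlt | hgt := hxμ.lt_or_gt
  · filter_upwards [nhdsWithin_le_nhds (lt_mem_nhds hlt)] with c hc hx using hc.not_gt hx.1.2.1
  by_cases hxΩ : x ∈ Ω
  · have hx : x ∈ puncturedCap Ω μ :=
      ⟨hxΩ, hgt, fun h0 => hxr (by rw [← h0, reflectAt_reflectAt])⟩
    have hr := h.isSteinerSymmetric.reflectAt_mem_of_mem_puncturedCap hμ hx
    filter_upwards [nhdsWithin_le_nhds ((h.tendsto_reflectDiff hm hr).eventually
      (lt_mem_nhds (hpos x hx)))] with c hc hx using hc.not_gt hx.2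
  · exact Eventually.of_forall fun c hx => hxΩ hx.1.1.1

theorem eventually_reflectDiffNonneg (h : IsCooperativeSystem m a f Ω U) (hn : 2 ≤ n)
    (hm : 1 ≤ m) (hμ : 0 < μ) (hnonneg : ReflectDiffNonneg m Ω U μ) :
    ∀ᶠ c in 𝓝[<] μ, ReflectDiffNonneg m Ω U c := by
  obtain ⟨L, hL, hchain⟩ := h.exists_forall_isCooperativeChain_reflectDiff hn hm (half_pos hμ)
  obtain ⟨η, hη, hsmall⟩ := exists_forall_isCooperativeChain_nonneg
    (E := EuclideanSpace ℝ (Fin n)) (by simpa) h.isBounded m hL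
  have hvol := (h.tendsto_volume_badSet hm hμ.le fun x hx =>
    h.reflectDiff_pos hn hm hμ hnonneg hx).eventually (gt_mem_nhds hη)
  filter_upwards [hvol, nhdsWithin_le_nhds (lt_mem_nhds (half_lt_self hμ))] with c hvolc hc
  have hc₀ : 0 ≤ c := (half_pos hμ).le.trans hc.le
  refine hsmall a _ (badSet Ω (U 0) c) _ _ inter_subset_left (hchain c hc.le) hvolc.le ?_
  refine fun x hx hxbad => not_lt.1 fun hneg =>
    hxbad ⟨⟨puncturedCap_subset hc₀ hx, hx.2.1, ?_⟩, hneg⟩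
  exact h.isSteinerSymmetric.reflectAt_mem_of_mem_puncturedCap hc₀ hx

theorem reflectDiffNonneg (h : IsCooperativeSystem m a f Ω U) (hn : 2 ≤ n) (hm : 1 ≤ m) :
    ∀ c > 0, ReflectDiffNonneg m Ω U c := by
  refine forall_gt_of_continuation ?_ (fun μ hμ => h.reflectDiffNonneg_of_forall_gt hμ.le)
    fun μ hμ => h.eventually_reflectDiffNonneg hn hm hμ
  obtain ⟨R, hR⟩ := h.isBounded.subset_closedBall 0
  filter_upwards [eventually_ge_atTop R] with c hc i _ x hx
  have hxR : x 0 ≤ R := (le_abs_self _).trans <| (PiLp.norm_apply_le x 0).trans <| by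
    simpa using hR hx.1
  exact absurd hx.2.1 (hxR.trans hc).not_gt

theorem strictAnti (h : IsCooperativeSystem m a f Ω U) (hn : 2 ≤ n) (hm : 1 ≤ m)
    {p q : EuclideanSpace ℝ (Fin n)} (hq : q ∈ Ω) (hpq : ∀ j, j ≠ 0 → p j = q j) (hp : 0 < p 0)
    (hlt : p 0 < q 0) : U 0 q < U 0 p := by
  set c := (p 0 + q 0) / 2 with hc
  have hc₀ : 0 < c := by linarith
  have hr : p = reflectAt c q := eq_reflectAt_iff.2 ⟨by rw [hc]; ring, hpq⟩
  have hqc : q ∈ puncturedCap Ω c :=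
    ⟨hq, show c < q 0 by linarith, fun h0 => ne_zero_of_apply_zero_pos hp (hr.trans h0)⟩
  rw [hr]
  exact sub_pos.1 (h.reflectDiff_pos hn hm hc₀ (h.reflectDiffNonneg hn hm c hc₀) hqc)

theorem le_reflectAt_zero (h : IsCooperativeSystem m a f Ω U) (hn : 2 ≤ n) (hm : 1 ≤ m)
    (hx : x ∈ Ω) (hx₀ : 0 < x 0) : U 0 x ≤ U 0 (reflectAt 0 x) := by
  have hmem : x ∈ puncturedCap Ω 0 :=
    ⟨hx, hx₀, (h.isSteinerSymmetric.reflectAt_zero_mem_diff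
      ⟨hx, ne_zero_of_apply_zero_pos hx₀⟩).2⟩
  exact sub_nonneg.1 (h.reflectDiffNonneg_of_forall_gt le_rfl (h.reflectDiffNonneg hn hm) 0 hm x
    hmem)

theorem comp_reflectAt_zero (h : IsCooperativeSystem m a f Ω U) :
    IsCooperativeSystem m a f Ω fun i x => U i (reflectAt 0 x) where
  isOpen := h.isOpen
  isBounded := h.isBounded
  isSteinerSymmetric := h.isSteinerSymmetric
  locallyLipschitzOn := h.locallyLipschitzOn
  map_zero_nonneg := h.map_zero_nonneg
  monotoneOn := h.monotoneOn
  coeff_nonneg := h.coeff_nonneg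
  contDiffOn := fun i hi => (h.contDiffOn i hi).comp (contDiff_reflectAt 0).contDiffOn
    fun _ hx => h.isSteinerSymmetric.reflectAt_zero_mem_diff hx
  laplacian_eq := fun i hi x hx => by
    rw [laplacian_comp_reflectAt,
      h.laplacian_eq i hi _ (h.isSteinerSymmetric.reflectAt_zero_mem_diff hx)]
  last_eq := fun x hx => h.last_eq _ (h.isSteinerSymmetric.reflectAt_zero_mem_diff hx)
  pos := fun x hx => h.pos _ (h.isSteinerSymmetric.reflectAt_zero_mem_diff hx)
  tendsto_frontier := fun i hi y hy => by
    have hmaps : MapsTo (reflectAt 0) (Ω \ {0}) (Ω \ {0}) := fun x hx =>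
      h.isSteinerSymmetric.reflectAt_zero_mem_diff hx
    have hyf : reflectAt 0 y ∈ frontier Ω := by
      have hΩ : MapsTo (reflectAt 0) Ω Ω := fun x hx =>
        h.isSteinerSymmetric x hx _ (fun j hj => reflectAt_apply_of_ne 0 x hj) (by simp)
      rw [h.isOpen.frontier_eq] at hy ⊢
      refine ⟨map_mem_closure (continuous_reflectAt 0) hy.1 hΩ, fun hr => hy.2 ?_⟩
      simpa using hΩ hr
    exact (h.tendsto_frontier i hi _ hyf).comp
      ((continuous_reflectAt 0).continuousWithinAt.tendsto_nhdsWithin hmaps)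
  bddBelow := fun i hi => (h.bddBelow i hi).mono <| image_subset_iff.2 fun _ hx =>
    mem_image_of_mem _ (h.isSteinerSymmetric.reflectAt_zero_mem_diff hx)

theorem comp_reflectX1_eq (h : IsCooperativeSystem m a f Ω U) (hn : 2 ≤ n) (hm : 1 ≤ m)
    (hx : x ∈ Ω) : U 0 (reflectX1 x) = U 0 x := by
  rw [reflectX1_eq_reflectAt]
  have hright : ∀ y ∈ Ω, 0 < y 0 → U 0 (reflectAt 0 y) = U 0 y := fun y hy hy₀ => by
    refine le_antisymm ?_ (h.le_reflectAt_zero hn hm hy hy₀)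
    simpa using h.comp_reflectAt_zero.le_reflectAt_zero hn hm hy hy₀
  obtain hneg | hzero | hpos := lt_trichotomy (x 0) 0
  · have hx₀ : x ≠ 0 := fun h0 => hneg.ne (by rw [h0, PiLp.zero_apply])
    have hr := (h.isSteinerSymmetric.reflectAt_zero_mem_diff ⟨hx, hx₀⟩).1
    simpa using (hright _ hr (by simpa using hneg)).symm
  · rw [reflectAt_eq_self hzero]
  · exact hright x hx hpos

end IsCooperativeSystem

end MovingPlanes

section PolynomialReduction

open Polynomial

variable {n m : ℕ} {u : EuclideanSpace ℝ (Fin n) → ℝ} {s : Set (EuclideanSpace ℝ (Fin n))}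
  {p : ℝ[X]}

theorem nonneg_of_symmCoeff_nonneg {α : Fin m → ℝ} (hα : ∀ k < m, 0 ≤ symmCoeff α k) (i : Fin m) :
    0 ≤ α i := by
  by_contra! hneg
  have hroot : ∑ k ∈ Finset.range (m + 1), symmCoeff α k * (-α i) ^ k = 0 := by
    rw [← det_diagonal_add_eq_sum_symmCoeff, Matrix.det_diagonal]
    exact Finset.prod_eq_zero (Finset.mem_univ i) (add_neg_cancel _)
  have hlower : 0 ≤ ∑ k ∈ Finset.range m, symmCoeff α k * (-α i) ^ k :=
    Finset.sum_nonneg fun k hk =>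
      mul_nonneg (hα k (Finset.mem_range.1 hk)) (pow_nonneg (neg_pos.2 hneg).le k)
  have htop : 0 < symmCoeff α m * (-α i) ^ m := by
    simpa [symmCoeff] using pow_pos (neg_pos.2 hneg) m
  rw [Finset.sum_range_succ] at hroot
  linarith

theorem laplacian_sum_mul {E ι : Type*} [NormedAddCommGroup E] [InnerProductSpace ℝ E]
    [FiniteDimensional ℝ E] (t : Finset ι) (b : ι → ℝ) (g : ι → E → ℝ) {x : E}
    (hg : ∀ k ∈ t, ContDiffAt ℝ 2 (g k) x) :
    Δ (fun y => ∑ k ∈ t, b k * g k y) x = ∑ k ∈ t, b k * Δ (g k) x := by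
  classical
  induction t using Finset.induction_on with
  | empty => simp
  | insert k t hk ih =>
    simp only [Finset.forall_mem_insert] at hg
    have hsum : ContDiffAt ℝ 2 (fun y => ∑ k ∈ t, b k * g k y) x :=
      ContDiffAt.sum fun j hj => contDiffAt_const.mul (hg.2 j hj)
    have hsmul : ContDiffAt ℝ 2 (b k • g k) x := hg.1.const_smul (b k)
    have hadd := hsmul.laplacian_add hsum
    rw [InnerProductSpace.laplacian_smul _ hg.1, ih hg.2] at hadd
    simp only [Finset.sum_insert hk]
    exact hadd

theorem negLaplacianPow_succ (k : ℕ) (u : EuclideanSpace ℝ (Fin n) → ℝ) :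
    negLaplacianPow (k + 1) u = -Δ (negLaplacianPow k u) :=
  Function.iterate_succ_apply' _ _ _

theorem contDiffOn_negLaplacianPow (hs : IsOpen s) {k r : ℕ}
    (hu : ContDiffOn ℝ (r + 2 * k : ℕ) u s) : ContDiffOn ℝ r (negLaplacianPow k u) s := by
  induction k generalizing r with
  | zero => exact hu
  | succ k ih =>
    rw [negLaplacianPow_succ]
    refine (contDiffOn_laplacian hs (ih ?_)).neg
    rwa [show r + 2 + 2 * k = r + 2 * (k + 1) by ring]

theorem sum_mul_X_add_C {R : Type*} [CommSemiring R] (p : R[X]) (b : R) (w : ℕ → R) :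
    (p * (X + C b)).sum (fun k c => c * w k) =
      p.sum (fun k c => c * w (k + 1)) + b * p.sum fun k c => c * w k := by
  have hadd (p q : R[X]) (w : ℕ → R) : (p + q).sum (fun k c => c * w k) =
      p.sum (fun k c => c * w k) + q.sum fun k c => c * w k :=
    sum_add_index _ _ _ (fun _ => zero_mul _) fun _ _ _ => add_mul _ _ _
  induction p using Polynomial.induction_on' with
  | add p q hp hq =>
    rw [add_mul, hadd, hp, hq, hadd, hadd]
    ring
  | monomial k c =>
    rw [mul_add, monomial_mul_X, monomial_mul_C, hadd]
    simp only [sum_monomial_index, zero_mul]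
    ring

/-- The differential operator `p(-Δ)`, applied to `u`. -/
noncomputable def polyNegLaplacian (p : ℝ[X]) (u : EuclideanSpace ℝ (Fin n) → ℝ)
    (x : EuclideanSpace ℝ (Fin n)) : ℝ :=
  p.sum fun k b => b * negLaplacianPow k u x

theorem polyNegLaplacian_one : polyNegLaplacian 1 u = u := by
  funext x
  rw [polyNegLaplacian, ← C_1, sum_C_index] <;> simp [negLaplacianPow]

theorem polyNegLaplacian_mul_X_add_C (b : ℝ) {x : EuclideanSpace ℝ (Fin n)}
    (hu : ∀ k ∈ p.support, ContDiffAt ℝ 2 (negLaplacianPow k u) x) :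
    polyNegLaplacian (p * (X + C b)) u x =
      -Δ (polyNegLaplacian p u) x + b * polyNegLaplacian p u x := by
  have hlap : -Δ (polyNegLaplacian p u) x = p.sum fun k c => c * negLaplacianPow (k + 1) u x := by
    unfold polyNegLaplacian Polynomial.sum
    simp only [laplacian_sum_mul _ _ _ hu, negLaplacianPow_succ, Pi.neg_apply, mul_neg,
      Finset.sum_neg_distrib]
  rw [hlap]
  exact sum_mul_X_add_C p b fun k => negLaplacianPow k u x

theorem contDiffOn_polyNegLaplacian {r : WithTop ℕ∞}
    (hu : ∀ k ∈ p.support, ContDiffOn ℝ r (negLaplacianPow k u) s) :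
    ContDiffOn ℝ r (polyNegLaplacian p u) s :=
  ContDiffOn.sum fun k hk => contDiffOn_const.mul (hu k hk)

theorem tendsto_polyNegLaplacian {l : Filter (EuclideanSpace ℝ (Fin n))}
    (hu : ∀ k ∈ p.support, Tendsto (negLaplacianPow k u) l (𝓝 0)) :
    Tendsto (polyNegLaplacian p u) l (𝓝 0) := by
  have hsum : Tendsto (polyNegLaplacian p u) l (𝓝 (∑ k ∈ p.support, p.coeff k * 0)) :=
    tendsto_finsetSum _ fun k hk => (hu k hk).const_mul _
  simpa only [mul_zero, Finset.sum_const_zero] using hsum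

theorem bddBelow_image_polyNegLaplacian (hp : ∀ k ∈ p.support, 0 ≤ p.coeff k)
    (hu : ∀ k ∈ p.support, BddBelow (negLaplacianPow k u '' s)) :
    BddBelow (polyNegLaplacian p u '' s) := by
  choose! b hb using hu
  refine ⟨p.sum fun k c => c * b k, forall_mem_image.2 fun x hx => ?_⟩
  exact Finset.sum_le_sum fun k hk =>
    mul_le_mul_of_nonneg_left (hb k hk (mem_image_of_mem _ hx)) (hp k hk)

/-- The polynomial `∏_{j < i} (X + aⱼ)`. -/
noncomputable def shiftProd (a : ℕ → ℝ) (i : ℕ) : ℝ[X] :=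
  ∏ j ∈ Finset.range i, (X + C (a j))

theorem shiftProd_succ (a : ℕ → ℝ) (i : ℕ) :
    shiftProd a (i + 1) = shiftProd a i * (X + C (a i)) :=
  Finset.prod_range_succ _ _

theorem natDegree_shiftProd_le (a : ℕ → ℝ) (i : ℕ) : (shiftProd a i).natDegree ≤ i :=
  (natDegree_prod_le _ _).trans (by simp)

theorem le_of_mem_support_shiftProd {a : ℕ → ℝ} {i k : ℕ} (hk : k ∈ (shiftProd a i).support) :
    k ≤ i :=
  (le_natDegree_of_mem_supp k hk).trans (natDegree_shiftProd_le a i)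

theorem coeff_shiftProd_nonneg {a : ℕ → ℝ} (ha : ∀ j, 0 ≤ a j) {i k : ℕ} (hk : k ≤ i) :
    0 ≤ (shiftProd a i).coeff k := by
  rw [shiftProd, Finset.prod_X_add_C_coeff _ _ (by simpa)]
  exact Finset.sum_nonneg fun t _ => Finset.prod_nonneg fun j _ => ha j

theorem coeff_shiftProd_extend (α : Fin m → ℝ) {k : ℕ} (hk : k ≤ m) :
    (shiftProd (Function.extend Fin.val α 0) m).coeff k = symmCoeff α k := by
  rw [shiftProd, Finset.prod_range]
  simp only [Fin.val_injective.extend_apply]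
  rw [Finset.prod_X_add_C_coeff _ _ (by simpa), Finset.card_univ, Fintype.card_fin, symmCoeff]

theorem polyNegLaplacian_shiftProd_extend (α : Fin m → ℝ) (x : EuclideanSpace ℝ (Fin n)) :
    polyNegLaplacian (shiftProd (Function.extend Fin.val α 0) m) u x =
      ∑ k ∈ Finset.range (m + 1), symmCoeff α k * negLaplacianPow k u x := by
  rw [polyNegLaplacian, sum_over_range' _ (f := fun k b => b * negLaplacianPow k u x)
    (fun _ => zero_mul _) (m + 1) (Nat.lt_succ_of_le (natDegree_shiftProd_le _ _))]
  exact Finset.sum_congr rfl fun k hk => by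
    rw [coeff_shiftProd_extend α (Finset.mem_range_succ_iff.1 hk)]

end PolynomialReduction

theorem isCooperativeSystem_polyNegLaplacian {n m : ℕ} [NeZero n] {α : Fin m → ℝ}
    (hα : ∀ k < m, 0 ≤ symmCoeff α k) {Ω : Set (EuclideanSpace ℝ (Fin n))} (hΩ : IsOpen Ω)
    (hbdd : Bornology.IsBounded Ω) (hsymm : IsSteinerSymmetric Ω) {f : ℝ → ℝ}
    (hf : LocallyLipschitzOn (Ici 0) f) (hf₀ : 0 ≤ f 0) (hmono : MonotoneOn f (Ici 0))
    {u : EuclideanSpace ℝ (Fin n) → ℝ} (hu : ContDiffOn ℝ (2 * m : ℕ) u (Ω \ {0}))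
    (heq : ∀ x ∈ Ω \ {0},
      ∑ k ∈ Finset.range (m + 1), symmCoeff α k * negLaplacianPow k u x = f (u x))
    (hpos : ∀ x ∈ Ω \ {0}, 0 < u x)
    (hnavier : ∀ j < m, ∀ y ∈ frontier Ω, Tendsto (negLaplacianPow j u) (𝓝[Ω \ {0}] y) (𝓝 0))
    (hbelow : ∀ j, 1 ≤ j → j < m → BddBelow (negLaplacianPow j u '' (Ω \ {0}))) :
    IsCooperativeSystem m (Function.extend Fin.val α 0) f Ω fun i =>
      polyNegLaplacian (shiftProd (Function.extend Fin.val α 0) i) u := by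
  set a : ℕ → ℝ := Function.extend Fin.val α 0 with ha
  have hopen : IsOpen (Ω \ {0}) := hΩ.sdiff isClosed_singleton
  have ha₀ : 0 ≤ a :=
    Function.extend_nonneg (nonneg_of_symmCoeff_nonneg hα) le_rfl
  have hzero : polyNegLaplacian (shiftProd a 0) u = u := polyNegLaplacian_one
  have hlt : ∀ {i k}, i < m → k ∈ (shiftProd a i).support → k < m := fun hi hk =>
    (le_of_mem_support_shiftProd hk).trans_lt hi
  have hsmooth : ∀ k < m, ContDiffOn ℝ 2 (negLaplacianPow k u) (Ω \ {0}) := fun k hk =>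
    contDiffOn_negLaplacianPow hopen (r := 2) (hu.of_le (by norm_cast; omega))
  have hbelow' : ∀ k < m, BddBelow (negLaplacianPow k u '' (Ω \ {0})) := fun k hk => by
    obtain rfl | hk₀ := k.eq_zero_or_pos
    · exact ⟨0, forall_mem_image.2 fun x hx => (hpos x hx).le⟩
    · exact hbelow k hk₀ hk
  refine ⟨hΩ, hbdd, hsymm, hf, hf₀, hmono, fun i _ => ha₀ i, fun i hi => ?_, fun i hi x hx => ?_,
    fun x hx => ?_, fun x hx => ?_, fun i hi y hy => ?_, fun i hi => ?_⟩
  · exact contDiffOn_polyNegLaplacian fun k hk => hsmooth k (hlt hi hk)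
  · rw [shiftProd_succ, polyNegLaplacian_mul_X_add_C _ fun k hk =>
      (hsmooth k (hlt hi hk)).contDiffAt (hopen.mem_nhds hx)]
    ring
  · rw [hzero, ha, polyNegLaplacian_shiftProd_extend, heq x hx]
  · rw [hzero]
    exact hpos x hx
  · exact tendsto_polyNegLaplacian fun k hk => hnavier k (hlt hi hk) y hy
  · exact bddBelow_image_polyNegLaplacian
      (fun k hk => coeff_shiftProd_nonneg ha₀ (le_of_mem_support_shiftProd hk))
      fun k hk => hbelow' k (hlt hi hk)

theorem theorem1p2_general {n m : ℕ} [NeZero n] (hn : 2 ≤ n) (hm : 1 ≤ m)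
    (α : Fin m → ℝ) (hα : ∀ k < m, 0 ≤ symmCoeff α k)
    (Ω : Set (EuclideanSpace ℝ (Fin n))) (hΩ : IsOpen Ω) (hbdd : Bornology.IsBounded Ω)
    (hsymm : IsSteinerSymmetric Ω)
    (f : ℝ → ℝ) (hf : LocallyLipschitzOn (Ici 0) f) (hf₀ : 0 ≤ f 0) (hmono : MonotoneOn f (Ici 0))
    (u : EuclideanSpace ℝ (Fin n) → ℝ) (hu : ContDiffOn ℝ (2 * m : ℕ) u (Ω \ {0}))
    (heq : ∀ x ∈ Ω \ {0},
      ∑ k ∈ Finset.range (m + 1), symmCoeff α k * negLaplacianPow k u x = f (u x))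
    (hpos : ∀ x ∈ Ω \ {0}, 0 < u x)
    (hnavier : ∀ j < m, ∀ y ∈ frontier Ω, Tendsto (negLaplacianPow j u) (𝓝[Ω \ {0}] y) (𝓝 0))
    (hbelow : ∀ j, 1 ≤ j → j < m → BddBelow (negLaplacianPow j u '' (Ω \ {0}))) :
    (∀ x ∈ Ω, u (reflectX1 x) = u x) ∧
    (∀ p ∈ Ω, ∀ q ∈ Ω, (∀ j, j ≠ 0 → p j = q j) → 0 < p 0 → p 0 < q 0 → u q < u p) := by
  have hU := isCooperativeSystem_polyNegLaplacian hα hΩ hbdd hsymm hf hf₀ hmono hu heq hpos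
    hnavier hbelow
  have hzero : polyNegLaplacian (shiftProd (Function.extend Fin.val α 0) 0) u = u :=
    polyNegLaplacian_one
  refine ⟨fun x hx => ?_, fun p _ q hq hpq hp hlt => ?_⟩
  · simpa only [hzero] using hU.comp_reflectX1_eq hn hm hx
  · simpa only [hzero] using hU.strictAnti hn hm hq hpq hp hlt

theorem theorem1p2 {n m : ℕ} [NeZero n] (hn : 2 ≤ n) (hm : 1 ≤ m)
    (α : Fin m → ℝ) (hα : ∀ k < m, 0 ≤ symmCoeff α k)
    (Ω : Set (EuclideanSpace ℝ (Fin n))) (hΩ : IsSymmetricX1Domain Ω)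
    (f : ℝ → ℝ) (hf : IsAdmissibleNonlinearity f)
    (u : EuclideanSpace ℝ (Fin n) → ℝ) (hu : IsPositiveNavierSolution α f Ω u) :
    (∀ x ∈ Ω, u (reflectX1 x) = u x) ∧
    (∀ p ∈ Ω, ∀ q ∈ Ω, (∀ j, j ≠ 0 → p j = q j) → 0 < p 0 → p 0 < q 0 → u q < u p) :=
  theorem1p2_general hn hm α hα Ω hΩ.isOpen hΩ.isBounded hΩ.isSteinerSymmetric f
    (fun _ _ => hf.lipschitz.imp fun _ hK => ⟨_, self_mem_nhdsWithin, hK⟩)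
    hf.zero_nonneg hf.monotone u hu.contDiffOn hu.equation hu.pos hu.navier hu.boundedBelow
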